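/- **Setting.** Write $z=x+\mathrm iy=\rho\,\mathrm e^{\mathrm i\theta}$ and, for $0<\alpha<\pi$, let $\mathfrak S_\alpha=\{-\alpha<\theta<0\}$ be the infinite sector of angle $\alpha$, with sides $I_{\rm in}=\{\theta=-\alpha\}$, $I_{\rm out}=\{\theta=0\}$. Consider the Robin problem $$\Delta\Phi=0\ \text{ in }\mathfrak S_\alpha,\qquad \frac{\partial\Phi}{\partial n}=\Phi\ \text{ on }\partial\mathfrak S_\alpha\setminus\{0\}\qquad(1)$$ ($n$ is the exterior unit normal). A solution is a complex-valued function $\Phi$, continuous on the closed sector and continuously differentiable up to the two open sides, which satisfies (1) classically. On $\mathbb C^2$ let $u\cdot v=u_1\overline{v_1}+u_2\overline{v_2}$. For $\mathbf h=(h_1,h_2)\in\mathbb C^2$ define the outgoing and incoming plane waves $$W^{\mathbf h}_{\rm out}(z)=\mathrm e^{y}\left(h_1\mathrm e^{\mathrm ix}+h_2\mathrm e^{-\mathrm ix}\right),\qquad W^{\mathbf h}_{\rm in}(z)=W^{(h_2,h_1)}_{\rm out}(\mathcal M_\alpha z),$$ where $\mathcal M_\alpha:(\rho,\theta)\mapsto(\rho,-\alpha-\theta)$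 is the reflection across the bisector. Let $\mathcal E=\{\pi/(2k): k=1,2,\dots\}$ be the set of exceptional angles. For $\alpha\notin\mathcal E$ put $$\mathtt A(\alpha)=\begin{pmatrix}\csc\frac{\pi^2}{2\alpha}&-\mathrm i\cot\frac{\pi^2}{2\alpha}\\ \mathrm i\cot\frac{\pi^2}{2\alpha}&\csc\frac{\pi^2}{2\alpha}\end{pmatrix}.$$ Put $\mathbf X_{\rm even}=\frac1{\sqrt2}(\mathrm e^{-\mathrm i\pi/4},\mathrm e^{\mathrm i\pi/4})$, $\mathbf X_{\rm odd}=\frac1{\sqrt2}(\mathrm e^{\mathrm i\pi/4},\mathrm e^{-\mathrm i\pi/4})$ and, for $\alpha=\pi/(2k)$, let $(\mathbf X(\alpha),\mathbf X^\perp(\alpha))$ be $(\mathbf X_{\rm even},\mathbf X_{\rm odd})$ if $k$ is even and $(\mathbf X_{\rm odd},\mathbf X_{\rm even})$ if $k$ is odd. **Theorem.** Let $0<\alpha<\pi$. (a) If $\alpha\notin\mathcal E$, there are constants $C_\alpha,\rho_\alpha>0$ depending only on $\alpha$ such that for every $\mathbf h_{\rm in}\in\mathbb C^2$ there exist $\mathbf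 h_{\rm out}\in\mathbb C^2$, namely $\mathbf h_{\rm out}=\mathtt A(\alpha)\mathbf h_{\rm in}$, and a solution $\Phi$ of (1) of the form $$\Phi=W^{\mathbf h_{\rm out}}_{\rm out}+W^{\mathbf h_{\rm in}}_{\rm in}+R\qquad(2)$$ with $$|R(z)|+\rho\,\|\nabla_{(x,y)}R(z)\|\le C\rho^{-\pi/\alpha}\quad\text{for all }z\in\mathfrak S_\alpha,\ \rho=|z|\ge\rho_\alpha,\qquad(3)$$ where $C=C_\alpha\|\mathbf h_{\rm in}\|$. (b) If $\alpha=\pi/(2k)$ with $k\in\{1,2,\dots\}$, there are constants $C_\alpha,\rho_\alpha>0$ depending only on $\alpha$ such that for any $\mathbf h_{\rm in},\mathbf h_{\rm out}\in\mathbb C^2$ with $$\mathbf h_{\rm in}\cdot\mathbf X(\alpha)=\mathbf h_{\rm out}\cdot\mathbf X^\perp(\alpha)=0$$ there is a solution $\Phi$ of (1) of the form (2) that satisfies (3) with $C=C_\alpha(\|\mathbf h_{\rm in}\|+\|\mathbf h_{\rm out}\|)$. -/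

import Mathlib

open scoped ComplexConjugate

/-- Exceptional angles: `π / (2k)` with `k = 1, 2, 3, …`. -/
def exceptionalAngles : Set ℝ :=
  {α | ∃ k : ℕ, 1 ≤ k ∧ α = Real.pi / (2 * k)}

/-- The parity of an angle; it equals `(-1)^k` at the exceptional angle `π / (2k)`. -/
noncomputable def angleParity (α : ℝ) : ℝ := Real.cos (Real.pi ^ 2 / (2 * α))

/-- The dot product of `ℂ²`, conjugate-linear in the second argument. -/
noncomputable def cdot (u v : EuclideanSpace ℂ (Fin 2)) : ℂ :=
  u 0 * conj (v 0) + u 1 * conj (v 1)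

/-- The vector `𝐞(t) = (e^{-it}, e^{it})`. -/
noncomputable def expVec (t : ℝ) : EuclideanSpace ℂ (Fin 2) :=
  !₂[Complex.exp (-(Complex.I * t)), Complex.exp (Complex.I * t)]

noncomputable def XEven : EuclideanSpace ℂ (Fin 2) :=
  !₂[(1 / (Real.sqrt 2 : ℂ)) * Complex.exp (-(Complex.I * (Real.pi / 4))),
     (1 / (Real.sqrt 2 : ℂ)) * Complex.exp (Complex.I * (Real.pi / 4))]

noncomputable def XOdd : EuclideanSpace ℂ (Fin 2) :=
  !₂[(1 / (Real.sqrt 2 : ℂ)) * Complex.exp (Complex.I * (Real.pi / 4)),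
     (1 / (Real.sqrt 2 : ℂ)) * Complex.exp (-(Complex.I * (Real.pi / 4)))]

open Classical in
/-- `𝐗(α)` for an exceptional angle `α` (so that the parity of `α` is `1` or `-1`). -/
noncomputable def XVec (α : ℝ) : EuclideanSpace ℂ (Fin 2) :=
  if angleParity α = 1 then XEven else XOdd

open Classical in
/-- `𝐗^⊥(α)` for an exceptional angle `α`. -/
noncomputable def XPerp (α : ℝ) : EuclideanSpace ℂ (Fin 2) :=
  if angleParity α = 1 then XOdd else XEven

/-- The vertex transfer matrix, with entries the cosecant and the cotangent of `π² / (2α)`;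
meaningful for non-exceptional `α`. -/
noncomputable def vertexTransfer (α : ℝ) : Matrix (Fin 2) (Fin 2) ℂ :=
  let a₁ : ℂ := ((1 / Real.sin (Real.pi ^ 2 / (2 * α)) : ℝ) : ℂ)
  let a₂ : ℂ :=
    ((Real.cos (Real.pi ^ 2 / (2 * α)) / Real.sin (Real.pi ^ 2 / (2 * α)) : ℝ) : ℂ)
  !![a₁, -Complex.I * a₂; Complex.I * a₂, a₁]

/-- The open sector `-α < θ < 0` (for `0 < α ≤ π`); the origin has argument `0` and so does not
belong to it. -/
def sector (α : ℝ) : Set ℂ := {z | -α < z.arg ∧ z.arg < 0}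

/-- The open side `θ = 0` of the sector, without the vertex. -/
def sideOut : Set ℂ := {z | ∃ t : ℝ, 0 < t ∧ z = t}

/-- The open side `θ = -α` of the sector, without the vertex. -/
def sideIn (α : ℝ) : Set ℂ := {z | ∃ t : ℝ, 0 < t ∧ z = t * Complex.exp (-(α * Complex.I))}

/-- The reflection `(ρ, θ) ↦ (ρ, -α - θ)` across the bisector `θ = -α/2`. -/
noncomputable def reflect (α : ℝ) (z : ℂ) : ℂ := Complex.exp (-(α * Complex.I)) * conj z

/-- The outgoing plane wave `e^y (h · 𝐞(x)) = e^y (h₁ e^{ix} + h₂ e^{-ix})`. -/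
noncomputable def waveOut (h : EuclideanSpace ℂ (Fin 2)) (z : ℂ) : ℂ :=
  (Real.exp z.im : ℂ) * cdot h (expVec z.re)

/-- The incoming plane wave: the reflection of the outgoing one with swapped amplitudes. -/
noncomputable def waveIn (α : ℝ) (h : EuclideanSpace ℂ (Fin 2)) (z : ℂ) : ℂ :=
  waveOut !₂[h 1, h 0] (reflect α z)

/-- Classical solutions of `ΔΦ = 0` in the sector, `∂Φ/∂n = Φ` on its two sides: harmonic inside,
continuous on the closed sector (vertex included), continuously differentiable up to the open
sides. The derivative on the sides is taken within the closed sector; the exterior unit normals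
are `i` on `θ = 0` and `-i e^{-iα}` on `θ = -α`. -/
structure IsRobinSolution (α : ℝ) (Φ : ℂ → ℂ) : Prop where
  harmonic : InnerProductSpace.HarmonicOnNhd Φ (sector α)
  continuousOn : ContinuousOn Φ (closure (sector α))
  contDiffOn : ContDiffOn ℝ 1 Φ (closure (sector α) \ {0})
  robin_out : ∀ z ∈ sideOut, fderivWithin ℝ Φ (closure (sector α)) z Complex.I = Φ z
  robin_in : ∀ z ∈ sideIn α, fderivWithin ℝ Φ (closure (sector α)) z
    (-Complex.I * Complex.exp (-(α * Complex.I))) = Φ z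

/-- The Euclidean norm of the gradient `(∂R/∂x, ∂R/∂y)` of a complex-valued function. -/
noncomputable def gradNorm (R : ℂ → ℂ) (z : ℂ) : ℝ :=
  Real.sqrt (‖fderiv ℝ R z 1‖ ^ 2 + ‖fderiv ℝ R z Complex.I‖ ^ 2)

/-- The part of `Φ` left after removing the outgoing and the incoming plane wave. -/
noncomputable def remainder (α : ℝ) (hIn hOut : EuclideanSpace ℂ (Fin 2)) (Φ : ℂ → ℂ) (z : ℂ) : ℂ :=
  Φ z - waveOut hOut z - waveIn α hIn z

/-- `|R(z)| + |z| |∇R(z)| ≤ C |z|^{-r}` for the points of the sector with `|z| ≥ ρ₀`. -/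
def RemainderBound (α : ℝ) (R : ℂ → ℂ) (r C ρ₀ : ℝ) : Prop :=
  ∀ z ∈ sector α, ρ₀ ≤ ‖z‖ → ‖R z‖ + ‖z‖ * gradNorm R z ≤ C * ‖z‖ ^ (-r)

/-!
Rotate the sector so that its bisector is the positive real axis, with `β = α / 2` and
`w = z e^{iβ}`, and look for the waves `f w + ε f (conj w)` that are even (`ε = 1`) or odd
(`ε = -1`) in the bisector, with `f` holomorphic for `Re w > 0`. If `f` superposes exponentials
`A(u) e^{-w e^u}`, the Robin condition on the side `arg w = β` compares `A` at `v - iβ` and at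
`v + iβ`: the contributions at a common `v` cancel as soon as `A` satisfies the Malyuzhinets
equation `(1 + i e^v) A(v - iβ) = -ε (1 - i e^v) A(v + iβ)`.

The Robin defect of a ladder of exponentials at `u = iφ, i(φ - 2β), …` therefore telescopes to its
two end terms, and the factors `1 ± i e^v` remove those at `v = ±iπ/2`: the exponentials next to
them are the plane waves along the sides. A ladder starting from one plane wave does not in general
reach the other one, so its loose end is cancelled by the residues of a Laplace integral of `A`
against a kernel with period `2iβ`. What is added to the plane waves is `O(ρ^{-π/α})`, because the
density of that integral decays like `e^{πx/(2β)}` as `x → -∞`.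

The even and odd waves have amplitudes `e^{∓iεσ}` with `2σ = π²/(2α) - π/2`. Their combinations
realize every incoming amplitude when `cos 2σ = sin (π²/(2α))` does not vanish, and exactly the
pairs of amplitudes with the two orthogonality conditions when it does.
-/

section StripResidue

open Complex Filter Topology MeasureTheory Set
open scoped Real

theorem intervalIntegral_inv_add_eq_log_sub_log {c : ℂ} (hc : 0 < c.im) {R : ℝ} (hR : 0 < R) :
    ∫ x in (-R)..R, ((x : ℂ) + c)⁻¹ = log (-I * (1 + c / R)) - log (I * (1 - c / R)) := by
  have hR' : (R : ℂ) ≠ 0 := ofReal_ne_zero.2 hR.ne'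
  have hne (x : ℝ) : (x : ℂ) + c ≠ 0 := fun h => by
    have := congrArg im h
    rw [add_im, ofReal_im, zero_add, zero_im] at this
    exact hc.ne' this
  have hprim : ∀ x ∈ uIcc (-R) R,
      HasDerivAt (fun x : ℝ => log (-I * ((x : ℂ) + c))) ((x : ℂ) + c)⁻¹ x := by
    intro x _
    have hlin : HasDerivAt (fun x : ℝ => -I * ((x : ℂ) + c)) (-I * 1) x :=
      ((ofRealCLM.hasDerivAt (x := x)).add_const c).const_mul _
    convert hlin.clog_real (.inl (by simpa using hc)) using 1
    field_simp
  have hright : -I * ((R : ℂ) + c) = R * (-I * (1 + c / R)) := by field_simp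
  have hleft : -I * (((-R : ℝ) : ℂ) + c) = R * (I * (1 - c / R)) := by
    push_cast; field_simp; ring
  have hright_ne := mul_ne_zero (neg_ne_zero.2 I_ne_zero) (hne R)
  have hleft_ne := mul_ne_zero (neg_ne_zero.2 I_ne_zero) (hne (-R))
  rw [intervalIntegral.integral_eq_sub_of_hasDerivAt hprim
    (Continuous.intervalIntegrable (.inv₀ (by fun_prop) hne) _ _)]
  rw [hright] at hright_ne ⊢
  rw [hleft] at hleft_ne ⊢
  rw [log_ofReal_mul hR (right_ne_zero_of_mul hright_ne),
    log_ofReal_mul hR (right_ne_zero_of_mul hleft_ne)]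
  ring

theorem tendsto_intervalIntegral_inv_add_of_im_pos {c : ℂ} (hc : 0 < c.im) :
    Tendsto (fun R : ℝ => ∫ x in (-R)..R, ((x : ℂ) + c)⁻¹) atTop (𝓝 (-(π * I))) := by
  have hcR : Tendsto (fun R : ℝ => c / (R : ℂ)) atTop (𝓝 0) := by
    have hinv : Tendsto (fun R : ℝ => ((R⁻¹ : ℝ) : ℂ)) atTop (𝓝 ((0 : ℝ) : ℂ)) :=
      (continuous_ofReal.tendsto 0).comp tendsto_inv_atTop_zero
    simpa [div_eq_mul_inv] using hinv.const_mul c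
  have hright : Tendsto (fun R : ℝ => log (-I * (1 + c / R))) atTop (𝓝 (log (-I))) :=
    (continuousAt_clog (.inr (by simp))).tendsto.comp
      (by simpa using (hcR.const_add 1).const_mul (-I))
  have hleft : Tendsto (fun R : ℝ => log (I * (1 - c / R))) atTop (𝓝 (log I)) :=
    (continuousAt_clog (.inr (by simp))).tendsto.comp
      (by simpa using (hcR.const_sub 1).const_mul I)
  have hvalue : log (-I) - log I = -(π * I) := by rw [log_neg_I, log_I]; ring
  rw [← hvalue]
  refine (hright.sub hleft).congr' ?_
  filter_upwards [eventually_gt_atTop 0] with R hR using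
    (intervalIntegral_inv_add_eq_log_sub_log hc hR).symm

theorem tendsto_intervalIntegral_inv_add_of_im_neg {c : ℂ} (hc : c.im < 0) :
    Tendsto (fun R : ℝ => ∫ x in (-R)..R, ((x : ℂ) + c)⁻¹) atTop (𝓝 (π * I)) := by
  have h := (tendsto_intervalIntegral_inv_add_of_im_pos (c := -c) (by simpa using hc)).neg
  rw [neg_neg] at h
  refine h.congr fun R => ?_
  have hreflect := intervalIntegral.integral_comp_neg (a := -R) (b := R)
    (fun x : ℝ => ((x : ℂ) + c)⁻¹)
  rw [neg_neg] at hreflect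
  rw [← intervalIntegral.integral_neg, ← hreflect]
  refine intervalIntegral.integral_congr fun x _ => ?_
  simp only [ofReal_neg, ← inv_neg, neg_add, neg_neg]

theorem integrable_exp_neg_mul_abs {δ : ℝ} (hδ : 0 < δ) :
    Integrable fun x : ℝ => Real.exp (-δ * |x|) := by
  rw [← integrableOn_univ, ← Iic_union_Ioi (a := (0 : ℝ)), integrableOn_union]
  constructor
  · refine (integrableOn_exp_mul_Iic hδ 0).congr_fun (fun x hx => ?_) measurableSet_Iic
    simp [abs_of_nonpos (mem_Iic.1 hx)]
  · refine (integrableOn_exp_mul_Ioi (neg_lt_zero.2 hδ) 0).congr_fun (fun x hx => ?_)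
      measurableSet_Ioi
    simp [abs_of_pos (mem_Ioi.1 hx)]

theorem integrable_of_continuous_of_norm_le_exp {E : Type*} [NormedAddCommGroup E] {h : ℝ → E}
    (hc : Continuous h) {C δ X : ℝ} (hδ : 0 < δ)
    (hb : ∀ x, X ≤ |x| → ‖h x‖ ≤ C * Real.exp (-δ * |x|)) : Integrable h := by
  rw [← integrableOn_univ, ← union_compl_self (Icc (-X) X), integrableOn_union]
  refine ⟨hc.continuousOn.integrableOn_compact isCompact_Icc,
    ((integrable_exp_neg_mul_abs hδ).const_mul C).integrableOn.mono' hc.aestronglyMeasurable ?_⟩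
  refine (ae_restrict_iff' measurableSet_Icc.compl).2 (.of_forall fun x hx => hb x ?_)
  by_contra! hlt
  exact hx (abs_le.1 hlt.le)

variable {a b : ℝ} {g : ℂ → ℂ} {v₀ : ℂ}

theorem dslope_eq_div_sub_mul_inv {v : ℂ} (hv : v ≠ v₀) :
    dslope g v₀ v = g v / (v - v₀) - g v₀ * (v - v₀)⁻¹ := by
  rw [dslope_of_ne _ hv, slope_def_field, sub_div, div_eq_mul_inv (g v₀)]

theorem tendsto_intervalIntegral_dslope_horizontal {y : ℝ} (hy : y ≠ v₀.im)
    (hint : Integrable fun x : ℝ => g (x + y * I) / (x + y * I - v₀)) {L : ℂ}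
    (hL : Tendsto (fun R : ℝ => ∫ x in (-R)..R, ((x : ℂ) + (y * I - v₀))⁻¹) atTop (𝓝 L)) :
    Tendsto (fun R : ℝ => ∫ x in (-R)..R, dslope g v₀ (x + y * I)) atTop
      (𝓝 ((∫ x : ℝ, g (x + y * I) / (x + y * I - v₀)) - g v₀ * L)) := by
  have hne (x : ℝ) : (x : ℂ) + (y * I - v₀) ≠ 0 := fun h => hy <| by
    have := congrArg im h
    simp only [add_im, sub_im, ofReal_im, im_ofReal_mul, I_im, zero_im] at this
    linarith
  have hinv : Continuous fun x : ℝ => g v₀ * ((x : ℂ) + (y * I - v₀))⁻¹ :=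
    continuous_const.mul (.inv₀ (by fun_prop) hne)
  refine ((intervalIntegral_tendsto_integral hint tendsto_neg_atTop_atBot tendsto_id).sub
    (hL.const_mul (g v₀))).congr fun R => ?_
  rw [id, ← intervalIntegral.integral_const_mul, ← intervalIntegral.integral_sub
    hint.intervalIntegrable (hinv.intervalIntegrable _ _)]
  refine intervalIntegral.integral_congr fun x _ => ?_
  simp only [← add_sub_assoc] at hne ⊢
  rw [dslope_eq_div_sub_mul_inv (sub_ne_zero.1 (hne x))]

theorem tendsto_intervalIntegral_dslope_vertical (hab : a ≤ b) {C δ X s : ℝ} (hδ : 0 < δ)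
    (hdecay : ∀ x y : ℝ, a ≤ y → y ≤ b → X ≤ |x| →
      ‖g (x + y * I) / (x + y * I - v₀)‖ ≤ C * Real.exp (-δ * |x|)) (hs : |s| = 1) :
    Tendsto (fun R : ℝ => ∫ y in a..b, dslope g v₀ ((s * R : ℝ) + y * I)) atTop (𝓝 0) := by
  have hbound : ∀ᶠ R : ℝ in atTop, ‖∫ y in a..b, dslope g v₀ ((s * R : ℝ) + y * I)‖ ≤
      (C * Real.exp (-δ * R) + ‖g v₀‖ * (R - |v₀.re|)⁻¹) * |b - a| := by
    filter_upwards [eventually_gt_atTop |v₀.re|, eventually_ge_atTop X] with R hR hRX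
    have hpos : 0 < R - |v₀.re| := sub_pos.2 hR
    have habs : |s * R| = R := by rw [abs_mul, hs, one_mul, abs_of_pos ((abs_nonneg _).trans_lt hR)]
    refine intervalIntegral.norm_integral_le_of_norm_le_const fun y hy => ?_
    rw [uIoc_of_le hab] at hy
    have hlow : R - |v₀.re| ≤ ‖((s * R : ℝ) : ℂ) + y * I - v₀‖ :=
      calc R - |v₀.re| = |s * R| - |v₀.re| := by rw [habs]
        _ ≤ |s * R - v₀.re| := abs_sub_abs_le_abs_sub _ _
        _ = |(((s * R : ℝ) : ℂ) + y * I - v₀).re| := by simp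
        _ ≤ _ := abs_re_le_norm _
    rw [dslope_eq_div_sub_mul_inv (sub_ne_zero.1 (norm_pos_iff.1 (hpos.trans_le hlow)))]
    refine (norm_sub_le _ _).trans (add_le_add ?_ ?_)
    · simpa only [habs] using hdecay (s * R) y hy.1.le hy.2 (hRX.trans_eq habs.symm)
    · rw [norm_mul, norm_inv]
      gcongr
  refine squeeze_zero_norm' hbound ?_
  have hexp : Tendsto (fun R => Real.exp (-δ * R)) atTop (𝓝 0) :=
    Real.tendsto_exp_atBot.comp (tendsto_id.const_mul_atTop_of_neg (neg_lt_zero.2 hδ))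
  have hinv : Tendsto (fun R => (R - |v₀.re|)⁻¹) atTop (𝓝 0) :=
    tendsto_inv_atTop_zero.comp (tendsto_atTop_add_const_right _ _ tendsto_id)
  simpa using ((hexp.const_mul C).add (hinv.const_mul ‖g v₀‖)).mul_const |b - a|

theorem integral_sub_integral_of_simple_pole_in_strip (ha : a < v₀.im) (hb : v₀.im < b)
    (hg : DifferentiableOn ℂ g (im ⁻¹' Icc a b)) {C δ X : ℝ} (hδ : 0 < δ)
    (hdecay : ∀ x y : ℝ, a ≤ y → y ≤ b → X ≤ |x| →
      ‖g (x + y * I) / (x + y * I - v₀)‖ ≤ C * Real.exp (-δ * |x|)) :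
    (∫ x : ℝ, g (x + a * I) / (x + a * I - v₀)) - (∫ x : ℝ, g (x + b * I) / (x + b * I - v₀)) =
      2 * π * I * g v₀ := by
  have hab : a ≤ b := (ha.trans hb).le
  have hstrip : im ⁻¹' Icc a b ∈ 𝓝 v₀ := continuous_im.continuousAt (Icc_mem_nhds ha hb)
  have hdiff : DifferentiableOn ℂ (dslope g v₀) (im ⁻¹' Icc a b) :=
    (differentiableOn_dslope hstrip).2 hg
  have hint (y : ℝ) (hay : a ≤ y) (hyb : y ≤ b) (hy : y ≠ v₀.im) :
      Integrable fun x : ℝ => g (x + y * I) / (x + y * I - v₀) := by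
    refine integrable_of_continuous_of_norm_le_exp (.div ?_ (by fun_prop) fun x h => hy ?_) hδ
      fun x => hdecay x y hay hyb
    · exact hg.continuousOn.comp_continuous (by fun_prop) fun x => by simp [hay, hyb]
    · simpa using congrArg im (sub_eq_zero.1 h)
  have hrect (R : ℝ) : (∫ x in (-R)..R, dslope g v₀ (x + a * I)) -
      (∫ x in (-R)..R, dslope g v₀ (x + b * I)) +
      I • (∫ y in a..b, dslope g v₀ ((1 * R : ℝ) + y * I)) -
      I • (∫ y in a..b, dslope g v₀ ((-1 * R : ℝ) + y * I)) = 0 := by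
    simpa using integral_boundary_rect_eq_zero_of_differentiableOn (dslope g v₀)
      (⟨-R, a⟩ : ℂ) (⟨R, b⟩ : ℂ) (hdiff.mono fun v hv => by
        simpa only [mem_preimage, uIcc_of_le hab] using hv.2)
  have hbottom := tendsto_intervalIntegral_dslope_horizontal ha.ne (hint a le_rfl hab ha.ne)
    (tendsto_intervalIntegral_inv_add_of_im_neg (by simpa using ha))
  have htop := tendsto_intervalIntegral_dslope_horizontal hb.ne' (hint b hab le_rfl hb.ne')
    (tendsto_intervalIntegral_inv_add_of_im_pos (by simpa using hb))
  have hright := tendsto_intervalIntegral_dslope_vertical hab hδ hdecay (s := 1) (by simp)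
  have hleft := tendsto_intervalIntegral_dslope_vertical hab hδ hdecay (s := -1) (by simp)
  have hlimit := tendsto_nhds_unique
    (((hbottom.sub htop).add (hright.const_smul I)).sub (hleft.const_smul I))
    (tendsto_const_nhds.congr fun R => (hrect R).symm)
  simp only [smul_zero, add_zero, sub_zero] at hlimit
  linear_combination hlimit

theorem integral_div_sub_integral_div_of_simple_zero_in_strip {D : ℂ → ℂ} (ha : a < v₀.im)
    (hb : v₀.im < b) (hg : DifferentiableOn ℂ g (im ⁻¹' Icc a b)) (hD : Differentiable ℂ D)
    (hD0 : D v₀ = 0) (hD' : deriv D v₀ ≠ 0)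
    (hDne : ∀ v : ℂ, a ≤ v.im → v.im ≤ b → D v = 0 → v = v₀) {C δ X : ℝ} (hδ : 0 < δ)
    (hdecay : ∀ x y : ℝ, a ≤ y → y ≤ b → X ≤ |x| →
      ‖g (x + y * I) / D (x + y * I)‖ ≤ C * Real.exp (-δ * |x|)) :
    (∫ x : ℝ, g (x + a * I) / D (x + a * I)) - (∫ x : ℝ, g (x + b * I) / D (x + b * I)) =
      2 * π * I * (g v₀ / deriv D v₀) := by
  have hslope : Differentiable ℂ (dslope D v₀) :=
    differentiableOn_univ.1 ((differentiableOn_dslope univ_mem).2 hD.differentiableOn)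
  have hfactor (v : ℂ) : dslope D v₀ v * (v - v₀) = D v := by
    rw [mul_comm, ← smul_eq_mul, sub_smul_dslope, hD0, sub_zero]
  have hne (v : ℂ) (hv : v ∈ im ⁻¹' Icc a b) : dslope D v₀ v ≠ 0 := fun h => by
    have hv₀ : v = v₀ := hDne v hv.1 hv.2 (by rw [← hfactor, h, zero_mul])
    rw [hv₀, dslope_same] at h
    exact hD' h
  have hquot (v : ℂ) : g v / dslope D v₀ v / (v - v₀) = g v / D v := by rw [div_div, hfactor]
  have h := integral_sub_integral_of_simple_pole_in_strip (g := fun v => g v / dslope D v₀ v)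
    ha hb (hg.div hslope.differentiableOn hne) hδ
    (fun x y hay hyb hX => by rw [hquot]; exact hdecay x y hay hyb hX)
  simpa only [hquot, dslope_same] using h

end StripResidue

section SechTransform

open Complex MeasureTheory Set
open scoped Real

theorem exp_abs_re_div_four_le_norm_cosh {v : ℂ} (hv : 1 ≤ |v.re|) :
    Real.exp |v.re| / 4 ≤ ‖cosh v‖ := by
  have hdiff : Real.exp |v.re| - Real.exp (-|v.re|) ≤ ‖exp v + exp (-v)‖ := by
    rcases abs_cases v.re with ⟨h, -⟩ | ⟨h, -⟩
    · simpa [norm_exp, h] using norm_sub_le_norm_add (exp v) (exp (-v))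
    · simpa [norm_exp, h, add_comm] using norm_sub_le_norm_add (exp (-v)) (exp v)
  have hhalf : Real.exp (-|v.re|) ≤ Real.exp |v.re| / 2 := by
    have hexp : Real.exp |v.re| = Real.exp (-|v.re|) * Real.exp (2 * |v.re|) := by
      rw [← Real.exp_add]; ring_nf
    nlinarith [Real.exp_pos (-|v.re|), Real.add_one_le_exp (2 * |v.re|)]
  have hcosh : ‖cosh v‖ = ‖exp v + exp (-v)‖ / 2 := by rw [cosh, norm_div, norm_ofNat]
  linarith

theorem cosh_ne_zero_of_abs_im_lt {u : ℂ} (hu : |u.im| < π / 2) : cosh u ≠ 0 := fun h => by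
  have hre : (cosh u).re = Real.cosh u.re * Real.cos u.im := by
    rw [← re_add_im u, cosh_add, cosh_mul_I, sinh_mul_I, ← ofReal_cosh, ← ofReal_sinh,
      ← ofReal_cos, ← ofReal_sin]
    simp [cos_ofReal_re]
  rw [h, zero_re] at hre
  exact (mul_pos (Real.cosh_pos _) (Real.cos_pos_of_mem_Ioo (abs_lt.1 hu))).ne hre

theorem eq_I_of_cosh_pi_div_two_mul_eq_zero {v : ℂ} (h0 : 0 ≤ v.im) (h2 : v.im ≤ 2)
    (h : cosh (π / 2 * v) = 0) : v = I := by
  rw [← cos_mul_I] at h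
  obtain ⟨k, hk⟩ := cos_eq_zero_iff.1 h
  have hv : v = -(2 * k + 1) * I := by
    have hvI : v * I = 2 * k + 1 :=
      mul_left_cancel₀ (by simp [Real.pi_ne_zero] : (π : ℂ) / 2 ≠ 0)
        (by rw [← mul_assoc, hk]; ring)
    linear_combination (-I) * hvI + v * I_sq
  have him : v.im = -(2 * k + 1) := by rw [hv]; simp
  have hk_neg : k < 0 := by exact_mod_cast (by linarith : (k : ℝ) < 0)
  have hk_gt : -2 < k := by exact_mod_cast (by linarith : (-2 : ℝ) < k)
  have hk_eq : k = -1 := by lia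
  rw [hv, hk_eq]
  push_cast
  ring

theorem norm_exp_I_mul_mul_le (u : ℂ) (x y : ℝ) :
    ‖exp (I * u * (x + y * I))‖ ≤ Real.exp (|u.re| * |y|) * Real.exp (|u.im| * |x|) := by
  have hre : (I * u * (x + y * I)).re = -(u.re * y) - u.im * x := by simp; ring
  rw [norm_exp, ← Real.exp_add, Real.exp_le_exp, hre, ← abs_mul, ← abs_mul]
  linarith [neg_abs_le (u.re * y), neg_abs_le (u.im * x)]

theorem norm_exp_div_cosh_pi_div_two_mul_le (u : ℂ) {x : ℝ} (hx : 1 ≤ |x|) (y : ℝ) :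
    ‖exp (I * u * (x + y * I)) / cosh (π / 2 * (x + y * I))‖ ≤
      4 * Real.exp (|u.re| * |y|) * Real.exp (-(π / 2 - |u.im|) * |x|) := by
  have hre : |((π : ℂ) / 2 * (x + y * I)).re| = π / 2 * |x| := by
    rw [show (π : ℂ) / 2 * (x + y * I) = ((π / 2 : ℝ) : ℂ) * (x + y * I) by push_cast; rfl,
      re_ofReal_mul, abs_mul, abs_of_pos (by positivity : 0 < π / 2)]
    simp
  have hcosh := exp_abs_re_div_four_le_norm_cosh (v := (π : ℂ) / 2 * (x + y * I))
    (by rw [hre]; nlinarith [Real.pi_gt_three])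
  rw [hre] at hcosh
  rw [norm_div, div_le_iff₀ ((by positivity : (0 : ℝ) < _).trans_le hcosh)]
  have hsplit : Real.exp (|u.im| * |x|) =
      Real.exp (-(π / 2 - |u.im|) * |x|) * Real.exp (π / 2 * |x|) := by
    rw [← Real.exp_add]; ring_nf
  calc _ ≤ Real.exp (|u.re| * |y|) * Real.exp (|u.im| * |x|) := norm_exp_I_mul_mul_le u x y
    _ = 4 * Real.exp (|u.re| * |y|) * Real.exp (-(π / 2 - |u.im|) * |x|) *
        (Real.exp (π / 2 * |x|) / 4) := by rw [hsplit]; ring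
    _ ≤ _ := by gcongr

variable {u : ℂ}

theorem integrable_exp_div_cosh (hu : |u.im| < π / 2) :
    Integrable fun x : ℝ => exp (I * u * x) / cosh (π / 2 * x) := by
  refine integrable_of_continuous_of_norm_le_exp
    (.div (by fun_prop) (by fun_prop) fun x => cosh_ne_zero_of_abs_im_lt ?_) (sub_pos.2 hu)
    fun x hx => by simpa using norm_exp_div_cosh_pi_div_two_mul_le u hx 0
  simp [div_eq_mul_inv, Real.pi_pos]

theorem exp_div_cosh_add_two_mul_I (u v : ℂ) :
    exp (I * u * (v + 2 * I)) / cosh (π / 2 * (v + 2 * I)) =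
      -exp (-2 * u) * (exp (I * u * v) / cosh (π / 2 * v)) := by
  have hcosh : cosh (π / 2 * (v + 2 * I)) = -cosh (π / 2 * v) := by
    rw [show (π : ℂ) / 2 * (v + 2 * I) = π / 2 * v + π * I by ring, cosh_add, cosh_mul_I,
      sinh_mul_I, cos_pi, sin_pi]
    ring
  have hexp : exp (I * u * (v + 2 * I)) = exp (-2 * u) * exp (I * u * v) := by
    rw [← exp_add]; congr 1; linear_combination (2 * u) * I_sq
  rw [hcosh, hexp]
  ring

/- The integrand is multiplied by `-e^{-2u}` under `x ↦ x + 2i`, so the residue at the only pole `i`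
in between determines the integral. -/
theorem integral_exp_div_cosh (hu : |u.im| < π / 2) :
    ∫ x : ℝ, exp (I * u * x) / cosh (π / 2 * x) = 2 / cosh u := by
  have hderiv : HasDerivAt (fun v : ℂ => cosh (π / 2 * v)) (I * (π / 2)) I := by
    have h := ((hasDerivAt_id I).const_mul ((π : ℂ) / 2)).ccosh
    rw [id, sinh_mul_I, sin_pi_div_two] at h
    simpa using h
  have hpi : (π : ℂ) ≠ 0 := ofReal_ne_zero.2 Real.pi_ne_zero
  have hresidue := integral_div_sub_integral_div_of_simple_zero_in_strip (a := 0) (b := 2) (v₀ := I)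
    (g := fun v => exp (I * u * v)) (D := fun v => cosh (π / 2 * v)) (by simp) (by norm_num)
    (by fun_prop) (by fun_prop) (by rw [cosh_mul_I, cos_pi_div_two])
    (by rw [hderiv.deriv]; simp [hpi])
    (fun v h0 h2 => eq_I_of_cosh_pi_div_two_mul_eq_zero h0 h2)
    (C := 4 * Real.exp (|u.re| * 2)) (X := 1) (sub_pos.2 hu) fun x y h0 h2 hx =>
      (norm_exp_div_cosh_pi_div_two_mul_le u hx y).trans (by rw [abs_of_nonneg h0]; gcongr)
  simp only [ofReal_zero, zero_mul, add_zero, ofReal_ofNat, exp_div_cosh_add_two_mul_I,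
    hderiv.deriv] at hresidue
  rw [integral_const_mul] at hresidue
  set J := ∫ x : ℝ, exp (I * u * x) / cosh (π / 2 * x)
  have hpole : 2 * π * I * (exp (I * u * I) / (I * (π / 2))) = 4 * exp (-u) := by
    rw [show I * u * I = -u by linear_combination u * I_sq]
    field_simp
    norm_num
  have hsq : exp (-2 * u) = exp (-u) * exp (-u) := by rw [← exp_add]; ring_nf
  have hinv : exp u * exp (-u) = 1 := by rw [← exp_add, add_neg_cancel, exp_zero]
  rw [hpole, hsq] at hresidue
  rw [eq_div_iff (cosh_ne_zero_of_abs_im_lt hu), cosh]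
  linear_combination (1 / 2) * exp u * hresidue + (2 - (1 / 2) * J * exp (-u)) * hinv

theorem cos_mul_div_eq_half_exp_add_exp (u v w : ℂ) :
    cos (u * v) / w = 1 / 2 * (exp (I * u * v) / w + exp (I * -u * v) / w) := by
  rw [cos, show I * u * v = u * v * I by ring, show I * -u * v = -(u * v) * I by ring]
  ring

theorem integrable_cos_div_cosh (hu : |u.im| < π / 2) :
    Integrable fun x : ℝ => cos (u * x) / cosh (π / 2 * x) := by
  simp only [cos_mul_div_eq_half_exp_add_exp]
  exact ((integrable_exp_div_cosh hu).add
    (integrable_exp_div_cosh (u := -u) (by simpa using hu))).const_mul _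

theorem integral_cos_div_cosh (hu : |u.im| < π / 2) :
    ∫ x : ℝ, cos (u * x) / cosh (π / 2 * x) = 2 / cosh u := by
  have hu' : |(-u).im| < π / 2 := by simpa using hu
  simp only [cos_mul_div_eq_half_exp_add_exp]
  rw [integral_const_mul, integral_add (integrable_exp_div_cosh hu) (integrable_exp_div_cosh hu'),
    integral_exp_div_cosh hu, integral_exp_div_cosh hu', cosh_neg]
  ring

theorem integral_Ioi_cos_div_cosh (hu : |u.im| < π / 2) :
    ∫ x : ℝ in Ioi 0, cos (u * x) / cosh (π / 2 * x) = 1 / cosh u := by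
  have hsplit := integral_add_compl (measurableSet_Ioi (a := (0 : ℝ))) (integrable_cos_div_cosh hu)
  have heven := integral_comp_neg_Ioi (0 : ℝ) (fun x : ℝ => cos (u * x) / cosh (π / 2 * x))
  simp only [ofReal_neg, mul_neg, cos_neg, cosh_neg, neg_zero] at heven
  rw [compl_Ioi, ← heven, integral_cos_div_cosh hu] at hsplit
  linear_combination (1 / 2) * hsplit

end SechTransform

section VersineTransform

open Complex Filter Topology MeasureTheory Set
open scoped Real

theorem hasDerivAt_integral_of_dominated_of_convex {α 𝕜 E : Type*} [MeasurableSpace α]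
    {μ : Measure α} [RCLike 𝕜] [NormedAddCommGroup E] [NormedSpace ℝ E] [NormedSpace 𝕜 E]
    {s : Set 𝕜} (hs : IsOpen s) (hconv : Convex ℝ s) {x₀ u : 𝕜} (hx₀ : x₀ ∈ s) (hu : u ∈ s)
    {F F' : 𝕜 → α → E} {b : α → ℝ} (hF_meas : ∀ u, AEStronglyMeasurable (F u) μ)
    (hF_int : Integrable (F x₀) μ) (hF'_meas : AEStronglyMeasurable (F' u) μ)
    (hF' : ∀ᵐ t ∂μ, ∀ v ∈ s, ‖F' v t‖ ≤ b t) (hb : Integrable b μ)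
    (hF_deriv : ∀ᵐ t ∂μ, ∀ v ∈ s, HasDerivAt (F · t) (F' v t) v) :
    Integrable (F u) μ ∧ HasDerivAt (fun v => ∫ t, F v t ∂μ) (∫ t, F' u t ∂μ) u := by
  have hdiff : Integrable (F u - F x₀) μ := by
    refine (hb.mul_const ‖u - x₀‖).mono' ((hF_meas u).sub (hF_meas x₀)) ?_
    filter_upwards [hF_deriv, hF'] with t hderiv hbound
    exact hconv.norm_image_sub_le_of_norm_hasDerivWithin_le
      (fun v hv => (hderiv v hv).hasDerivWithinAt) hbound hx₀ hu
  have hint : Integrable (F u) μ := by simpa using hdiff.add hF_int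
  exact ⟨hint, (hasDerivAt_integral_of_dominated_loc_of_deriv_le (hs.mem_nhds hu)
    (.of_forall hF_meas) hint hF'_meas hF' hb hF_deriv).2⟩

theorem isOpen_abs_im_lt (y : ℝ) : IsOpen {u : ℂ | |u.im| < y} :=
  isOpen_lt (continuous_abs.comp continuous_im) continuous_const

theorem convex_abs_im_lt (y : ℝ) : Convex ℝ {u : ℂ | |u.im| < y} := by
  simp only [abs_lt]
  exact (convex_Ioo (-y) y).linear_preimage imLm

theorem norm_cos_le_exp_abs_im (z : ℂ) : ‖cos z‖ ≤ Real.exp |z.im| := by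
  have hpos : ‖exp (z * I)‖ ≤ Real.exp |z.im| := by
    rw [norm_exp, Real.exp_le_exp]; simpa using neg_le_abs z.im
  have hneg : ‖exp (-z * I)‖ ≤ Real.exp |z.im| := by
    rw [norm_exp, Real.exp_le_exp]; simpa using le_abs_self z.im
  rw [cos, norm_div, norm_ofNat]
  linarith [norm_add_le (exp (z * I)) (exp (-z * I))]

theorem norm_sin_le_exp_abs_im_mul_norm (z : ℂ) : ‖sin z‖ ≤ Real.exp |z.im| * ‖z‖ := by
  have hconv : Convex ℝ {w : ℂ | |w.im| ≤ |z.im|} := by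
    simp only [abs_le]
    exact (convex_Icc (-|z.im|) |z.im|).linear_preimage imLm
  have h0 : (0 : ℂ) ∈ {w : ℂ | |w.im| ≤ |z.im|} := by simp
  have hz : z ∈ {w : ℂ | |w.im| ≤ |z.im|} := le_refl |z.im|
  simpa using hconv.norm_image_sub_le_of_norm_hasDerivWithin_le
    (fun w _ => (hasDerivAt_sin w).hasDerivWithinAt)
    (fun w hw => (norm_cos_le_exp_abs_im w).trans (Real.exp_le_exp.2 hw)) h0 hz

theorem one_sub_cos_re_le {x y Y : ℝ} (hy : |y| ≤ Y) :
    1 - (cos (x + y * I)).re ≤ (1 - (cos x).re) - (1 - (cos (Y * I)).re) := by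
  have hxy : (cos (x + y * I)).re = Real.cos x * Real.cosh y := by
    rw [cos_add, cos_mul_I, sin_mul_I, ← ofReal_cos, ← ofReal_sin, ← ofReal_cosh, ← ofReal_sinh]
    simp [cos_ofReal_re]
  have hY : (cos (Y * I)).re = Real.cosh Y := by rw [cos_mul_I, cosh_ofReal_re]
  have hmono : Real.cosh y ≤ Real.cosh Y := Real.cosh_le_cosh.2 (hy.trans (le_abs_self Y))
  rw [hxy, hY, cos_ofReal_re]
  nlinarith [Real.one_le_cosh y, Real.neg_one_le_cos x]

/-- The sine transform `∫₀^∞ sin(uτ) W(τ) dτ` of a weight `W` at a complex point `u`. -/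
noncomputable def sineTransform (W : ℝ → ℝ) (u : ℂ) : ℂ :=
  ∫ τ : ℝ in Ioi 0, sin (u * τ) * W τ

/-- The primitive `∫₀^∞ (1 - cos(uτ)) τ⁻¹ W(τ) dτ`, vanishing at `0`, of the sine transform. -/
noncomputable def versineTransform (W : ℝ → ℝ) (u : ℂ) : ℂ :=
  ∫ τ : ℝ in Ioi 0, (1 - cos (u * τ)) / τ * W τ

/-- A weight on `(0, ∞)` which may have a simple pole at `0` and which is `O(e^{-aτ} / τ)`, so that
its sine transform extends to the strip `|Im u| < a`. -/
structure IsExpDecayingWeight (a : ℝ) (W : ℝ → ℝ) : Prop where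
  continuousOn : ContinuousOn W (Ioi 0)
  exists_mul_abs_le : ∃ C, ∀ τ, 0 < τ → τ * |W τ| ≤ C * Real.exp (-a * τ)

namespace IsExpDecayingWeight

variable {a : ℝ} {W : ℝ → ℝ} {u : ℂ}

theorem aestronglyMeasurable (hW : IsExpDecayingWeight a W) {f : ℝ → ℂ} (hf : Continuous f) :
    AEStronglyMeasurable (fun τ => f τ * W τ) (volume.restrict (Ioi 0)) :=
  (hf.continuousOn.mul (continuous_ofReal.comp_continuousOn hW.continuousOn)).aestronglyMeasurable
    measurableSet_Ioi

theorem exists_integrableOn_bound (hW : IsExpDecayingWeight a W) {y : ℝ} (hy : y < a) :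
    ∃ b : ℝ → ℝ, IntegrableOn b (Ioi 0) ∧ ∀ τ, 0 < τ → Real.exp (y * τ) * (τ * |W τ|) ≤ b τ := by
  obtain ⟨C, hC⟩ := hW.exists_mul_abs_le
  refine ⟨fun τ => C * Real.exp ((y - a) * τ),
    (integrableOn_exp_mul_Ioi (sub_neg.2 hy) 0).const_mul C, fun τ hτ => ?_⟩
  calc _ ≤ Real.exp (y * τ) * (C * Real.exp (-a * τ)) :=
        mul_le_mul_of_nonneg_left (hC τ hτ) (Real.exp_pos _).le
    _ = C * Real.exp ((y - a) * τ) := by rw [mul_left_comm, ← Real.exp_add]; ring_nf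

theorem hasDerivAt_sineTransform (hW : IsExpDecayingWeight a W) (hu : |u.im| < a) :
    HasDerivAt (sineTransform W) (∫ τ : ℝ in Ioi 0, cos (u * τ) * (τ * W τ)) u := by
  obtain ⟨y, huy, hya⟩ := exists_between hu
  obtain ⟨b, hb, hWb⟩ := hW.exists_integrableOn_bound hya
  refine (hasDerivAt_integral_of_dominated_of_convex (x₀ := 0)
    (F := fun v (τ : ℝ) => sin (v * τ) * W τ) (F' := fun v τ => cos (v * τ) * (τ * W τ))
    (isOpen_abs_im_lt y) (convex_abs_im_lt y) (by simpa using (abs_nonneg _).trans_lt huy) huy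
    (fun v => hW.aestronglyMeasurable (f := fun τ => sin (v * τ)) (by fun_prop)) (by simp) ?_ ?_
    hb ?_).2
  · simpa only [mul_assoc] using
      hW.aestronglyMeasurable (f := fun τ => cos (u * τ) * τ) (by fun_prop)
  · refine ae_restrict_of_forall_mem measurableSet_Ioi fun τ hτ v hv => le_trans ?_ (hWb τ hτ)
    rw [norm_mul, norm_mul, norm_real, norm_real, Real.norm_of_nonneg (le_of_lt hτ),
      Real.norm_eq_abs]
    refine mul_le_mul_of_nonneg_right ((norm_cos_le_exp_abs_im _).trans (Real.exp_le_exp.2 ?_))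
      (mul_nonneg (le_of_lt hτ) (abs_nonneg _))
    rw [im_mul_ofReal, abs_mul, abs_of_pos (mem_Ioi.1 hτ)]
    exact mul_le_mul_of_nonneg_right (le_of_lt hv) (le_of_lt hτ)
  · refine .of_forall fun τ v _ => ?_
    simpa [mul_assoc] using ((hasDerivAt_mul_const (x := v) (τ : ℂ)).csin).mul_const (W τ : ℂ)

theorem hasDerivAt_versineTransform (hW : IsExpDecayingWeight a W) (hu : |u.im| < a) :
    IntegrableOn (fun τ : ℝ => (1 - cos (u * τ)) / τ * W τ) (Ioi 0) ∧
      HasDerivAt (versineTransform W) (sineTransform W u) u := by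
  obtain ⟨y, huy, hya⟩ := exists_between hu
  obtain ⟨b, hb, hWb⟩ := hW.exists_integrableOn_bound hya
  refine hasDerivAt_integral_of_dominated_of_convex (x₀ := 0)
    (F := fun v (τ : ℝ) => (1 - cos (v * τ)) / τ * W τ) (F' := fun v τ => sin (v * τ) * W τ)
    (b := fun τ => b τ * (‖u‖ + 1))
    ((isOpen_abs_im_lt y).inter (Metric.isOpen_ball (x := (0 : ℂ)) (ε := ‖u‖ + 1)))
    ((convex_abs_im_lt y).inter (convex_ball _ _))
    ⟨by simpa using (abs_nonneg _).trans_lt huy, Metric.mem_ball_self (by positivity)⟩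
    ⟨huy, by simp⟩ (fun v => ?_) (by simp)
    (hW.aestronglyMeasurable (f := fun τ => sin (u * τ)) (by fun_prop)) ?_ (hb.mul_const _) ?_
  · refine ContinuousOn.aestronglyMeasurable (.mul (.div (by fun_prop) (by fun_prop)
      fun τ hτ => ofReal_ne_zero.2 (ne_of_gt hτ)) ?_) measurableSet_Ioi
    exact continuous_ofReal.comp_continuousOn hW.continuousOn
  · refine ae_restrict_of_forall_mem measurableSet_Ioi fun τ hτ v hv => ?_
    have hτ0 : 0 < τ := hτ
    have hv_im : |v.im| < y := hv.1
    have hv_norm : ‖v‖ < ‖u‖ + 1 := by simpa using hv.2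
    calc ‖sin (v * τ) * W τ‖ ≤ Real.exp |(v * τ).im| * ‖v * τ‖ * |W τ| := by
          rw [norm_mul, norm_real, Real.norm_eq_abs]
          gcongr
          exact norm_sin_le_exp_abs_im_mul_norm _
      _ = Real.exp (|v.im| * τ) * (τ * |W τ|) * ‖v‖ := by
          rw [im_mul_ofReal, abs_mul, abs_of_pos hτ0, norm_mul, norm_real,
            Real.norm_of_nonneg hτ0.le]
          ring
      _ ≤ Real.exp (y * τ) * (τ * |W τ|) * (‖u‖ + 1) := by gcongr
      _ ≤ b τ * (‖u‖ + 1) := by gcongr; exact hWb τ hτ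
  · refine ae_restrict_of_forall_mem measurableSet_Ioi fun τ hτ v _ => ?_
    convert! ((((hasDerivAt_mul_const (x := v) (τ : ℂ)).ccos.const_sub 1).div_const
      (τ : ℂ)).mul_const (W τ : ℂ)) using 1
    rw [neg_mul, neg_neg, mul_div_cancel_right₀ _ (ofReal_ne_zero.2 (ne_of_gt hτ))]

theorem re_versineTransform (hW : IsExpDecayingWeight a W) (hu : |u.im| < a) :
    IntegrableOn (fun τ : ℝ => (1 - (cos (u * τ)).re) * (W τ / τ)) (Ioi 0) ∧
      (versineTransform W u).re = ∫ τ : ℝ in Ioi 0, (1 - (cos (u * τ)).re) * (W τ / τ) := by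
  have hint := (hW.hasDerivAt_versineTransform hu).1
  have hre (τ : ℝ) : ((1 - cos (u * τ)) / τ * W τ).re = (1 - (cos (u * τ)).re) * (W τ / τ) := by
    rw [show (1 - cos (u * τ)) / τ * W τ = (1 - cos (u * τ)) * ((W τ / τ : ℝ) : ℂ) by
      push_cast; ring, re_mul_ofReal, sub_re, one_re]
  have hint_re := hint.re
  have hintegral_re := integral_re hint
  simp only [RCLike.re_eq_complex_re, hre] at hint_re hintegral_re
  exact ⟨hint_re, hintegral_re.symm⟩

theorem re_versineTransform_ofReal_le {a' c x : ℝ} {V : ℝ → ℝ} (hV : IsExpDecayingWeight a V)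
    (hW : IsExpDecayingWeight a' W) (ha : 0 < a) (ha' : 0 < a')
    (hle : ∀ τ, 0 < τ → V τ ≤ c * W τ) :
    (versineTransform V x).re ≤ c * (versineTransform W x).re := by
  obtain ⟨hV_int, hV_re⟩ := hV.re_versineTransform (u := x) (by simpa)
  obtain ⟨hW_int, hW_re⟩ := hW.re_versineTransform (u := x) (by simpa)
  rw [hV_re, hW_re, ← integral_const_mul]
  refine setIntegral_mono_on hV_int (hW_int.const_mul c) measurableSet_Ioi fun τ hτ => ?_
  have hτ0 : 0 < τ := hτ
  have hversine : 0 ≤ 1 - (cos (x * τ)).re := by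
    rw [← ofReal_mul, cos_ofReal_re]
    exact sub_nonneg.2 (Real.cos_le_one _)
  calc _ ≤ (1 - (cos (x * τ)).re) * (c * W τ / τ) := by gcongr; exact hle τ hτ0
    _ = _ := by ring

theorem re_versineTransform_add_mul_I_le (hW : IsExpDecayingWeight a W)
    (hpos : ∀ τ, 0 < τ → 0 ≤ W τ) {x y Y : ℝ} (hy : |y| ≤ Y) (hY : Y < a) :
    (versineTransform W (x + y * I)).re ≤
      (versineTransform W x).re - (versineTransform W (Y * I)).re := by
  have hY0 : 0 ≤ Y := (abs_nonneg y).trans hy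
  obtain ⟨hx_int, hx_re⟩ := hW.re_versineTransform (u := x) (by simpa using hY0.trans_lt hY)
  obtain ⟨hxy_int, hxy_re⟩ := hW.re_versineTransform (u := x + y * I)
    (by simpa using hy.trans_lt hY)
  obtain ⟨hY_int, hY_re⟩ := hW.re_versineTransform (u := Y * I)
    (by simpa [abs_of_nonneg hY0] using hY)
  rw [hx_re, hxy_re, hY_re, ← integral_sub hx_int hY_int]
  refine setIntegral_mono_on hxy_int (hx_int.sub hY_int) measurableSet_Ioi fun τ hτ => ?_
  have hτ0 : 0 < τ := hτ
  have hcos := one_sub_cos_re_le (x := x * τ) (y := y * τ) (Y := Y * τ)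
    (by rw [abs_mul, abs_of_pos hτ0]; gcongr)
  push_cast at hcos
  rw [← sub_mul, show (x + y * I) * τ = x * τ + y * τ * I by ring,
    show Y * I * τ = Y * τ * I by ring]
  exact mul_le_mul_of_nonneg_right hcos (div_nonneg (hpos τ hτ0) hτ0.le)

end IsExpDecayingWeight

theorem versineTransform_neg (W : ℝ → ℝ) (u : ℂ) :
    versineTransform W (-u) = versineTransform W u := by
  simp [versineTransform]

end VersineTransform

section Malyuzhinets

open Complex Filter Topology MeasureTheory Set
open scoped Real

/-- The weight `1 / cosh(π τ / 2)`. -/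
noncomputable def sechWeight (τ : ℝ) : ℝ := 1 / Real.cosh (π / 2 * τ)

theorem sechWeight_pos (τ : ℝ) : 0 < sechWeight τ := one_div_pos.2 (Real.cosh_pos _)

theorem continuous_sechWeight : Continuous sechWeight :=
  continuous_const.div (by fun_prop) fun _ => (Real.cosh_pos _).ne'

theorem sechWeight_le_two_mul_exp (τ : ℝ) : sechWeight τ ≤ 2 * Real.exp (-(π / 2) * τ) := by
  have hinv : Real.exp (-(π / 2) * τ) * Real.exp (π / 2 * τ) = 1 := by
    rw [← Real.exp_add, ← add_mul, neg_add_cancel, zero_mul, Real.exp_zero]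
  rw [sechWeight, div_le_iff₀ (Real.cosh_pos _), Real.cosh_eq]
  nlinarith [Real.exp_pos (-(π / 2 * τ)), Real.exp_pos (-(π / 2) * τ)]

theorem isExpDecayingWeight_sechWeight_div :
    IsExpDecayingWeight (π / 2) fun τ => sechWeight τ / τ where
  continuousOn := continuous_sechWeight.continuousOn.div continuousOn_id fun _ hτ => ne_of_gt hτ
  exists_mul_abs_le := ⟨2, fun τ hτ => by
    rw [abs_div, abs_of_pos hτ, mul_div_cancel₀ _ hτ.ne', abs_of_pos (sechWeight_pos τ)]
    exact sechWeight_le_two_mul_exp τ⟩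

/-- The Gudermannian function in the strip `|Im v| < π / 2`: the odd primitive of `1 / cosh`. -/
noncomputable def gudermannian : ℂ → ℂ := sineTransform fun τ => sechWeight τ / τ

theorem gudermannian_zero : gudermannian 0 = 0 := by simp [gudermannian, sineTransform]

variable {v : ℂ}

theorem hasDerivAt_gudermannian (hv : |v.im| < π / 2) :
    HasDerivAt gudermannian (1 / cosh v) v := by
  rw [← integral_Ioi_cos_div_cosh hv]
  refine (isExpDecayingWeight_sechWeight_div.hasDerivAt_sineTransform hv).congr_deriv
    (setIntegral_congr_fun measurableSet_Ioi fun τ hτ => ?_)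
  have hτ0 : (τ : ℂ) ≠ 0 := ofReal_ne_zero.2 (ne_of_gt hτ)
  simp only [sechWeight]
  push_cast
  field_simp

theorem one_add_I_mul_exp_mul_one_sub (v : ℂ) :
    (1 + I * exp v) * (1 - I * exp v) = 2 * exp v * cosh v := by
  have hinv : exp v * exp (-v) = 1 := by rw [← exp_add, add_neg_cancel, exp_zero]
  rw [cosh]
  linear_combination (-(exp v) ^ 2) * I_sq - hinv

theorem one_add_I_mul_exp_ne_zero (hv : |v.im| < π / 2) : 1 + I * exp v ≠ 0 :=
  left_ne_zero_of_mul <| (one_add_I_mul_exp_mul_one_sub v).trans_ne <|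
    mul_ne_zero (mul_ne_zero two_ne_zero (exp_ne_zero v)) (cosh_ne_zero_of_abs_im_lt hv)

theorem exp_I_mul_gudermannian (hv : |v.im| < π / 2) :
    exp (I * gudermannian v) * (1 - I * exp v) = -I * (1 + I * exp v) := by
  have hderiv (u : ℂ) (hu : |u.im| < π / 2) : HasDerivAt
      (fun v => exp (I * gudermannian v) * ((1 - I * exp v) / (1 + I * exp v))) 0 u := by
    have hne := one_add_I_mul_exp_ne_zero hu
    have hcosh := cosh_ne_zero_of_abs_im_lt hu
    convert! (((hasDerivAt_gudermannian hu).const_mul I).cexp).mul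
      ((((hasDerivAt_exp u).const_mul I).const_sub 1).div
        (((hasDerivAt_exp u).const_mul I).const_add 1) hne) using 1
    simp only [Pi.div_apply]
    field_simp
    linear_combination (-(exp (I * gudermannian u)) * I) * one_add_I_mul_exp_mul_one_sub u
  have hconst := (isOpen_abs_im_lt (π / 2)).is_const_of_deriv_eq_zero
    (convex_abs_im_lt _).isPreconnected
    (fun u hu => (hderiv u hu).differentiableAt.differentiableWithinAt)
    (fun u hu => (hderiv u hu).deriv) hv (y := 0) (by simp [Real.pi_pos])
  have hne := one_add_I_mul_exp_ne_zero hv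
  have hI : (1 : ℂ) + I ≠ 0 := fun h => by simpa using congrArg re h
  simp only [gudermannian_zero, mul_zero, exp_zero, mul_one, one_mul] at hconst
  rw [← mul_div_assoc, div_eq_div_iff hne hI] at hconst
  exact mul_right_cancel₀ hI (by linear_combination hconst + (1 + I * exp v) * I_sq)

theorem abs_re_gudermannian_le (x : ℝ) : |(gudermannian x).re| ≤ π / 2 := by
  have hderiv (x : ℝ) :
      HasDerivAt (fun x : ℝ => (gudermannian x).re - 2 * Real.arctan (Real.exp x)) 0 x := by
    have hgd := (hasDerivAt_gudermannian (v := x) (by simp [Real.pi_pos])).real_of_complex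
    convert! hgd.sub (((Real.hasDerivAt_exp x).arctan).const_mul 2) using 1
    rw [← ofReal_cosh, ← ofReal_one, ← ofReal_div, ofReal_re, Real.cosh_eq, Real.exp_neg]
    field_simp
    ring
  have hconst := is_const_of_deriv_eq_zero (fun x => (hderiv x).differentiableAt)
    (fun x => (hderiv x).deriv) x 0
  simp only [ofReal_zero, gudermannian_zero, zero_re, Real.exp_zero, Real.arctan_one] at hconst
  rw [abs_le]
  constructor <;>
    linarith [Real.arctan_pos.2 (Real.exp_pos x), Real.arctan_lt_pi_div_two (Real.exp x)]

theorem re_versineTransform_sechWeight_div_le (x : ℝ) :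
    (versineTransform (fun τ => sechWeight τ / τ) x).re ≤ π / 2 * |x| := by
  have hderiv (x : ℝ) : HasDerivAt
      (fun x : ℝ => (versineTransform (fun τ => sechWeight τ / τ) x).re) (gudermannian x).re x :=
    (isExpDecayingWeight_sechWeight_div.hasDerivAt_versineTransform
      (by simp [Real.pi_pos])).2.real_of_complex
  have hmvt := convex_univ.norm_image_sub_le_of_norm_hasDerivWithin_le
    (fun x _ => (hderiv x).hasDerivWithinAt) (fun x _ => abs_re_gudermannian_le x)
    (mem_univ (0 : ℝ)) (mem_univ x)
  exact (le_abs_self _).trans (by simpa [versineTransform] using hmvt)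

/-- The weight `1 / (2 sinh(β τ) cosh(π τ / 2))`. -/
noncomputable def cschSechWeight (β τ : ℝ) : ℝ := 1 / (2 * Real.sinh (β * τ)) * sechWeight τ

variable {β τ : ℝ}

theorem cschSechWeight_pos (hβ : 0 < β) (hτ : 0 < τ) : 0 < cschSechWeight β τ :=
  mul_pos (one_div_pos.2 (mul_pos two_pos (Real.sinh_pos_iff.2 (mul_pos hβ hτ)))) (sechWeight_pos τ)

theorem cschSechWeight_le (hβ : 0 < β) (hτ : 0 < τ) :
    cschSechWeight β τ ≤ 1 / (2 * β) * (sechWeight τ / τ) := by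
  have hsinh : β * τ ≤ Real.sinh (β * τ) := Real.self_le_sinh_iff.2 (by positivity)
  calc _ ≤ 1 / (2 * (β * τ)) * sechWeight τ :=
        mul_le_mul_of_nonneg_right (by gcongr) (sechWeight_pos τ).le
    _ = _ := by field_simp

theorem mul_exp_le_one_add_two_mul_mul_sinh {x : ℝ} :
    x * Real.exp x ≤ (1 + 2 * x) * Real.sinh x := by
  have hsq : Real.exp (2 * x) * Real.exp (-x) = Real.exp x := by rw [← Real.exp_add]; ring_nf
  have hexp : (2 * x + 1) * Real.exp (-x) ≤ Real.exp x := by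
    rw [← hsq]
    exact mul_le_mul_of_nonneg_right (Real.add_one_le_exp _) (Real.exp_pos _).le
  rw [Real.sinh_eq]
  linarith

theorem mul_cschSechWeight_le (hβ : 0 < β) (hτ : 0 < τ) :
    τ * cschSechWeight β τ ≤ (1 + 2 * β * τ) / β * Real.exp (-(β + π / 2) * τ) := by
  have _ : 0 < Real.sinh (β * τ) := Real.sinh_pos_iff.2 (mul_pos hβ hτ)
  have hquot : τ / (2 * Real.sinh (β * τ)) ≤
      (1 + 2 * β * τ) / (2 * β) * Real.exp (-(β * τ)) := by
    rw [div_le_iff₀ (by positivity), Real.exp_neg]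
    have h := mul_exp_le_one_add_two_mul_mul_sinh (x := β * τ)
    field_simp
    rwa [show τ * 2 * β = 2 * (β * τ) by ring, mul_comm τ β]
  calc τ * cschSechWeight β τ = τ / (2 * Real.sinh (β * τ)) * sechWeight τ := by
        rw [cschSechWeight]; ring
    _ ≤ (1 + 2 * β * τ) / (2 * β) * Real.exp (-(β * τ)) * (2 * Real.exp (-(π / 2) * τ)) :=
        mul_le_mul hquot (sechWeight_le_two_mul_exp τ) (sechWeight_pos τ).le (by positivity)
    _ = (1 + 2 * β * τ) / β * (Real.exp (-(β * τ)) * Real.exp (-(π / 2) * τ)) := by field_simp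
    _ = _ := by rw [← Real.exp_add]; ring_nf

theorem isExpDecayingWeight_cschSechWeight (hβ : 0 < β) {a : ℝ} (ha : a < β + π / 2) :
    IsExpDecayingWeight a (cschSechWeight β) where
  continuousOn := .mul (.div (by fun_prop) (by fun_prop) fun τ hτ =>
    (mul_pos two_pos (Real.sinh_pos_iff.2 (mul_pos hβ hτ))).ne') continuous_sechWeight.continuousOn
  exists_mul_abs_le := by
    obtain ⟨δ, hδ, rfl⟩ : ∃ δ, 0 < δ ∧ a = β + π / 2 - δ := ⟨β + π / 2 - a, by linarith, by ring⟩
    refine ⟨(1 + 2 * β / δ) / β, fun τ hτ => ?_⟩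
    have hgrowth : 1 + 2 * β * τ ≤ (1 + 2 * β / δ) * Real.exp (δ * τ) :=
      calc 1 + 2 * β * τ = 1 + 2 * β / δ * (δ * τ) := by field_simp
        _ ≤ 1 * Real.exp (δ * τ) + 2 * β / δ * Real.exp (δ * τ) := by
          gcongr
          · rw [one_mul]; exact Real.one_le_exp (by positivity)
          · linarith [Real.add_one_le_exp (δ * τ)]
        _ = _ := by ring
    rw [abs_of_pos (cschSechWeight_pos hβ hτ)]
    calc _ ≤ (1 + 2 * β * τ) / β * Real.exp (-(β + π / 2) * τ) := mul_cschSechWeight_le hβ hτ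
      _ ≤ (1 + 2 * β / δ) * Real.exp (δ * τ) / β * Real.exp (-(β + π / 2) * τ) := by gcongr
      _ = (1 + 2 * β / δ) / β * (Real.exp (δ * τ) * Real.exp (-(β + π / 2) * τ)) := by ring
      _ = _ := by rw [← Real.exp_add]; ring_nf

/-- The logarithm of a Malyuzhinets function: an even solution `M` of the difference equation
`M(v + iβ) - M(v - iβ) = i gd v`. -/
noncomputable def malyuzhinetsLog (β : ℝ) : ℂ → ℂ := versineTransform (cschSechWeight β)

theorem malyuzhinetsLog_neg (β : ℝ) (u : ℂ) : malyuzhinetsLog β (-u) = malyuzhinetsLog β u :=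
  versineTransform_neg _ u

theorem differentiableAt_malyuzhinetsLog (hβ : 0 < β) {u : ℂ} (hu : |u.im| < β + π / 2) :
    DifferentiableAt ℂ (malyuzhinetsLog β) u := by
  obtain ⟨a, hua, ha⟩ := exists_between hu
  have hW := isExpDecayingWeight_cschSechWeight hβ ha
  exact (hW.hasDerivAt_versineTransform hua).2.differentiableAt

theorem malyuzhinetsLog_add_sub (hβ : 0 < β) (hv : |v.im| < π / 2) :
    malyuzhinetsLog β (v + I * β) - malyuzhinetsLog β (v - I * β) = I * gudermannian v := by
  obtain ⟨a, hva, ha⟩ := exists_between hv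
  have hW := isExpDecayingWeight_cschSechWeight hβ (a := β + a) (by linarith)
  have hint_add := (hW.hasDerivAt_versineTransform (u := v + I * β)
    (by rw [abs_lt] at hva ⊢; constructor <;> simp <;> linarith)).1
  have hint_sub := (hW.hasDerivAt_versineTransform (u := v - I * β)
    (by rw [abs_lt] at hva ⊢; constructor <;> simp <;> linarith)).1
  rw [malyuzhinetsLog, versineTransform, versineTransform, ← integral_sub hint_add hint_sub,
    gudermannian, sineTransform, ← integral_const_mul]
  refine setIntegral_congr_fun measurableSet_Ioi fun τ hτ => ?_
  have hτ0 : (τ : ℂ) ≠ 0 := ofReal_ne_zero.2 (ne_of_gt hτ)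
  have hsinh : sinh (β * τ) ≠ 0 := by
    rw [← ofReal_mul, ← ofReal_sinh]
    exact_mod_cast (Real.sinh_pos_iff.2 (mul_pos hβ hτ)).ne'
  simp only [cschSechWeight]
  push_cast
  rw [show (v + I * β) * τ = v * τ + β * τ * I by ring,
    show (v - I * β) * τ = v * τ - β * τ * I by ring, cos_add, cos_sub, sin_mul_I]
  generalize sinh (β * τ) = S at hsinh ⊢
  field_simp
  ring

theorem re_malyuzhinetsLog_ofReal_le (hβ : 0 < β) (x : ℝ) :
    (malyuzhinetsLog β x).re ≤ π / (4 * β) * |x| := by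
  have hW := isExpDecayingWeight_cschSechWeight hβ (a := β) (by linarith [Real.pi_pos])
  calc _ ≤ 1 / (2 * β) * (versineTransform (fun τ => sechWeight τ / τ) x).re :=
        hW.re_versineTransform_ofReal_le isExpDecayingWeight_sechWeight_div hβ (by positivity)
          fun τ hτ => cschSechWeight_le hβ hτ
    _ ≤ 1 / (2 * β) * (π / 2 * |x|) := by gcongr; exact re_versineTransform_sechWeight_div_le x
    _ = _ := by ring

theorem exists_re_malyuzhinetsLog_le (hβ : 0 < β) {Y : ℝ} (hY : Y < β + π / 2) :
    ∃ C : ℝ, ∀ x y : ℝ, |y| ≤ Y →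
      (malyuzhinetsLog β (x + y * I)).re ≤ π / (4 * β) * |x| + C := by
  obtain ⟨a, hYa, ha⟩ := exists_between hY
  refine ⟨-(malyuzhinetsLog β (Y * I)).re, fun x y hy => ?_⟩
  have h := (isExpDecayingWeight_cschSechWeight hβ ha).re_versineTransform_add_mul_I_le
    (fun τ hτ => (cschSechWeight_pos hβ hτ).le) (x := x) hy hYa
  exact h.trans (by
    rw [← sub_eq_add_neg]; exact sub_le_sub_right (re_malyuzhinetsLog_ofReal_le hβ x) _)

end Malyuzhinets

section LaplaceIntegral

open Complex Filter Topology MeasureTheory Set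
open scoped Real

section RealIntegral

variable {r s : ℝ}

theorem rpow_sub_one_mul_exp_comp_exp (x : ℝ) :
    |Real.exp x| • (Real.exp x ^ (s - 1) * Real.exp (-(r * Real.exp x))) =
      Real.exp (-(r * Real.exp x) + s * x) := by
  rw [abs_of_pos (Real.exp_pos x), smul_eq_mul, ← Real.exp_mul, ← Real.exp_add, ← Real.exp_add]
  ring_nf

theorem integrable_exp_neg_mul_exp_add_mul (hr : 0 < r) (hs : 0 < s) :
    Integrable fun x : ℝ => Real.exp (-(r * Real.exp x) + s * x) := by
  have h : IntegrableOn (fun x : ℝ => x ^ (s - 1) * Real.exp (-(r * x))) (Real.exp '' univ) := by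
    rw [image_univ, Real.range_exp]
    simpa using integrableOn_rpow_mul_exp_neg_mul_rpow (by linarith : -1 < s - 1) zero_lt_one hr
  rw [integrableOn_image_iff_integrableOn_abs_deriv_smul .univ
    (fun x _ => (Real.hasDerivAt_exp x).hasDerivWithinAt) Real.exp_injective.injOn] at h
  simpa only [rpow_sub_one_mul_exp_comp_exp, integrableOn_univ] using h

theorem integral_exp_neg_mul_exp_add_mul (hr : 0 < r) (hs : 0 < s) :
    ∫ x : ℝ, Real.exp (-(r * Real.exp x) + s * x) = Real.Gamma s * r ^ (-s) := by
  have h := integral_image_eq_integral_abs_deriv_smul .univ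
    (fun x _ => (Real.hasDerivAt_exp x).hasDerivWithinAt) Real.exp_injective.injOn
    fun x : ℝ => x ^ (s - 1) * Real.exp (-(r * x))
  simp only [rpow_sub_one_mul_exp_comp_exp, image_univ, Real.range_exp, Measure.restrict_univ,
    Real.integral_rpow_mul_exp_neg_mul_Ioi hs hr] at h
  rw [← h, Real.rpow_neg hr.le, one_div, Real.inv_rpow hr.le, mul_comm]

end RealIntegral

/-- The Laplace integral `∫ e^{-w ζ} D(log ζ) dζ / ζ` in the variable `x = log ζ`. -/
noncomputable def laplaceLog (D : ℝ → ℂ) (w : ℂ) : ℂ :=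
  ∫ x : ℝ, exp (-(w * Real.exp x)) * D x

theorem norm_exp_neg_mul_exp (w : ℂ) (x : ℝ) :
    ‖exp (-(w * Real.exp x))‖ = Real.exp (-(w.re * Real.exp x)) := by
  rw [norm_exp, neg_re, re_mul_ofReal]

variable {D : ℝ → ℂ} {C s : ℝ} {w : ℂ}

theorem norm_exp_neg_mul_exp_mul_le (hb : ∀ x, ‖D x‖ ≤ C * Real.exp (s * x)) (w : ℂ) (x : ℝ) :
    ‖exp (-(w * Real.exp x)) * D x‖ ≤ C * Real.exp (-(w.re * Real.exp x) + s * x) := by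
  rw [norm_mul, norm_exp_neg_mul_exp, Real.exp_add, mul_left_comm]
  exact mul_le_mul_of_nonneg_left (hb x) (Real.exp_pos _).le

theorem norm_exp_mul_le (hb : ∀ x, ‖D x‖ ≤ C * Real.exp (s * x)) (x : ℝ) :
    ‖Real.exp x * D x‖ ≤ C * Real.exp ((s + 1) * x) := by
  rw [norm_mul, norm_real, Real.norm_of_nonneg (Real.exp_pos x).le, add_one_mul,
    Real.exp_add, ← mul_assoc, mul_comm]
  exact mul_le_mul_of_nonneg_right (hb x) (Real.exp_pos _).le

theorem integrable_exp_neg_mul_exp_mul (hD : AEStronglyMeasurable D) (hs : 0 < s)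
    (hb : ∀ x, ‖D x‖ ≤ C * Real.exp (s * x)) (hw : 0 < w.re) :
    Integrable fun x : ℝ => exp (-(w * Real.exp x)) * D x :=
  ((integrable_exp_neg_mul_exp_add_mul hw hs).const_mul C).mono'
    (.mul (by fun_prop) hD) (.of_forall (norm_exp_neg_mul_exp_mul_le hb w))

theorem norm_laplaceLog_le (hs : 0 < s) (hb : ∀ x, ‖D x‖ ≤ C * Real.exp (s * x))
    (hw : 0 < w.re) : ‖laplaceLog D w‖ ≤ C * Real.Gamma s * w.re ^ (-s) := by
  rw [mul_assoc, ← integral_exp_neg_mul_exp_add_mul hw hs, ← integral_const_mul]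
  exact norm_integral_le_of_norm_le ((integrable_exp_neg_mul_exp_add_mul hw hs).const_mul C)
    (.of_forall (norm_exp_neg_mul_exp_mul_le hb w))

theorem hasDerivAt_laplaceLog (hD : AEStronglyMeasurable D) (hs : 0 < s)
    (hb : ∀ x, ‖D x‖ ≤ C * Real.exp (s * x)) (hw : 0 < w.re) :
    HasDerivAt (laplaceLog D) (-laplaceLog (fun x => Real.exp x * D x) w) w := by
  have hC : 0 ≤ C := by simpa using (norm_nonneg _).trans (hb 0)
  rw [laplaceLog, ← integral_neg]
  refine (hasDerivAt_integral_of_dominated_loc_of_deriv_le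
    (F := fun w x => exp (-(w * Real.exp x)) * D x)
    (F' := fun w x => -(exp (-(w * Real.exp x)) * (Real.exp x * D x)))
    (bound := fun x => C * Real.exp (-(w.re / 2 * Real.exp x) + (s + 1) * x))
    ((isOpen_lt continuous_const continuous_re).mem_nhds (half_lt_self hw))
    (.of_forall fun v => .mul (by fun_prop) hD) (integrable_exp_neg_mul_exp_mul hD hs hb hw)
    (.neg (.mul (by fun_prop) (.mul (by fun_prop) hD)))
    (.of_forall fun x v (hv : w.re / 2 < v.re) => ?_)
    ((integrable_exp_neg_mul_exp_add_mul (half_pos hw) (by linarith)).const_mul C)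
    (.of_forall fun x v _ => ?_)).2
  · rw [norm_neg]
    exact (norm_exp_neg_mul_exp_mul_le (norm_exp_mul_le hb) v x).trans (by gcongr)
  · convert! ((hasDerivAt_id v).mul_const (Real.exp x : ℂ)).neg.cexp.mul_const (D x) using 1
    simp only [id, Pi.neg_apply]
    ring

theorem norm_deriv_laplaceLog_le (hD : AEStronglyMeasurable D) (hs : 0 < s)
    (hb : ∀ x, ‖D x‖ ≤ C * Real.exp (s * x)) (hw : 0 < w.re) :
    ‖deriv (laplaceLog D) w‖ ≤ C * Real.Gamma (s + 1) * w.re ^ (-(s + 1)) := by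
  rw [(hasDerivAt_laplaceLog hD hs hb hw).deriv, norm_neg]
  exact norm_laplaceLog_le (by linarith) (norm_exp_mul_le hb) hw

theorem continuousOn_laplaceLog (hD : Integrable D) :
    ContinuousOn (laplaceLog D) {w | 0 ≤ w.re} := by
  refine continuousOn_of_dominated (bound := fun x => ‖D x‖)
    (fun w _ => .mul (by fun_prop) hD.aestronglyMeasurable)
    (fun w (hw : 0 ≤ w.re) => .of_forall fun x => ?_) hD.norm
    (.of_forall fun x => by fun_prop)
  rw [norm_mul, norm_exp_neg_mul_exp]
  exact mul_le_of_le_one_left (norm_nonneg _)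
    (Real.exp_le_one_iff.2 (neg_nonpos.2 (mul_nonneg hw (Real.exp_pos x).le)))

end LaplaceIntegral

section DecayingProfile

open Complex MeasureTheory
open scoped Real

/-- A function on the closed right half-plane that is holomorphic inside, continuous up to the
boundary, and decays like `|w|^{-μ}` with its derivative in the sector `|arg w| ≤ β`. -/
structure IsDecayingProfile (β μ : ℝ) (g : ℂ → ℂ) : Prop where
  differentiableAt : ∀ w : ℂ, 0 < w.re → DifferentiableAt ℂ g w
  continuousOn : ContinuousOn g {w | 0 ≤ w.re}
  decay : ∃ C, 0 ≤ C ∧ ∀ ρ θ : ℝ, 1 ≤ ρ → |θ| ≤ β →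
    ‖g (ρ * exp (θ * I))‖ + ρ * ‖deriv g (ρ * exp (θ * I))‖ ≤ C * ρ ^ (-μ)

theorem re_polar (ρ θ : ℝ) : (ρ * exp (θ * I)).re = ρ * Real.cos θ := by
  rw [re_ofReal_mul, exp_ofReal_mul_I_re]

variable {β μ ρ θ : ℝ}

theorem re_polar_pos (hρ : 0 < ρ) (hθ : |θ| < π / 2) : 0 < (ρ * exp (θ * I)).re := by
  rw [re_polar]
  exact mul_pos hρ (Real.cos_pos_of_mem_Ioo (abs_lt.1 hθ))

theorem cos_le_cos_of_abs_le (hβ : β < π / 2) (hθ : |θ| ≤ β) : Real.cos β ≤ Real.cos θ := by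
  rw [← Real.cos_abs θ]
  exact Real.cos_le_cos_of_nonneg_of_le_pi (abs_nonneg _) (by linarith [Real.pi_pos]) hθ

namespace IsDecayingProfile

variable {g g' : ℂ → ℂ}

theorem add (hβ : β < π / 2) (hg : IsDecayingProfile β μ g) (hg' : IsDecayingProfile β μ g') :
    IsDecayingProfile β μ (fun w => g w + g' w) where
  differentiableAt w hw := (hg.differentiableAt w hw).add (hg'.differentiableAt w hw)
  continuousOn := hg.continuousOn.add hg'.continuousOn
  decay := by
    obtain ⟨C, hC, h⟩ := hg.decay
    obtain ⟨C', hC', h'⟩ := hg'.decay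
    refine ⟨C + C', add_nonneg hC hC', fun ρ θ hρ hθ => ?_⟩
    have hρ0 : 0 < ρ := by linarith
    have hre := re_polar_pos hρ0 (hθ.trans_lt hβ)
    set w := ρ * exp (θ * I)
    have hderiv : deriv (fun w => g w + g' w) w = deriv g w + deriv g' w :=
      deriv_add (hg.differentiableAt _ hre) (hg'.differentiableAt _ hre)
    calc _ ≤ ‖g w‖ + ‖g' w‖ + ρ * (‖deriv g w‖ + ‖deriv g' w‖) := by
          rw [hderiv]
          gcongr <;> exact norm_add_le _ _
      _ ≤ _ := by linarith [h ρ θ hρ hθ, h' ρ θ hρ hθ]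

theorem const_mul (hβ : β < π / 2) (hg : IsDecayingProfile β μ g) (c : ℂ) :
    IsDecayingProfile β μ (fun w => c * g w) where
  differentiableAt w hw := (hg.differentiableAt w hw).const_mul c
  continuousOn := continuousOn_const.mul hg.continuousOn
  decay := by
    obtain ⟨C, hC, h⟩ := hg.decay
    refine ⟨‖c‖ * C, by positivity, fun ρ θ hρ hθ => ?_⟩
    have hre := re_polar_pos (by linarith : 0 < ρ) (hθ.trans_lt hβ)
    rw [deriv_const_mul _ (hg.differentiableAt _ hre), norm_mul, norm_mul]
    linarith [mul_le_mul_of_nonneg_left (h ρ θ hρ hθ) (norm_nonneg c)]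

theorem zero : IsDecayingProfile β μ (fun _ => 0) where
  differentiableAt w _ := by fun_prop
  continuousOn := continuousOn_const
  decay := ⟨0, le_rfl, fun ρ θ _ _ => by simp⟩

theorem sum (hβ : β < π / 2) {ι : Type*} (s : Finset ι) {g : ι → ℂ → ℂ}
    (hg : ∀ i ∈ s, IsDecayingProfile β μ (g i)) :
    IsDecayingProfile β μ (fun w => ∑ i ∈ s, g i w) := by
  classical
  induction s using Finset.induction_on with
  | empty => simpa using zero
  | insert i s hi ih =>
    simp only [Finset.sum_insert hi]
    exact add hβ (hg i (Finset.mem_insert_self i s))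
      (ih fun j hj => hg j (Finset.mem_insert_of_mem hj))

end IsDecayingProfile

theorem isDecayingProfile_laplaceLog {D : ℝ → ℂ} {C : ℝ} (hβ0 : 0 ≤ β) (hβ : β < π / 2)
    (hμ : 0 < μ) (hD : Integrable D) (hb : ∀ x, ‖D x‖ ≤ C * Real.exp (μ * x)) :
    IsDecayingProfile β μ (laplaceLog D) where
  differentiableAt w hw :=
    (hasDerivAt_laplaceLog hD.aestronglyMeasurable hμ hb hw).differentiableAt
  continuousOn := continuousOn_laplaceLog hD
  decay := by
    have hC : 0 ≤ C := by simpa using (norm_nonneg _).trans (hb 0)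
    have hcos : 0 < Real.cos β := Real.cos_pos_of_mem_Ioo ⟨by linarith, hβ⟩
    have _ := Real.Gamma_pos_of_pos hμ
    have _ := Real.Gamma_pos_of_pos (by linarith : 0 < μ + 1)
    refine ⟨C * Real.Gamma μ * Real.cos β ^ (-μ) +
      C * Real.Gamma (μ + 1) * Real.cos β ^ (-(μ + 1)), by positivity, fun ρ θ hρ hθ => ?_⟩
    have hρ0 : 0 < ρ := by linarith
    have hre := re_polar_pos hρ0 (hθ.trans_lt hβ)
    have hpow (s : ℝ) (hs : 0 < s) :
        (ρ * exp (θ * I)).re ^ (-s) ≤ Real.cos β ^ (-s) * ρ ^ (-s) := by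
      rw [mul_comm (_ ^ _), ← Real.mul_rpow hρ0.le hcos.le]
      refine Real.rpow_le_rpow_of_nonpos (by positivity) ?_ (by linarith)
      rw [re_polar]
      exact mul_le_mul_of_nonneg_left (cos_le_cos_of_abs_le hβ hθ) hρ0.le
    have hρpow : ρ * ρ ^ (-(μ + 1)) = ρ ^ (-μ) := by
      rw [← Real.rpow_one_add' hρ0.le (by linarith)]
      ring_nf
    calc _ ≤ C * Real.Gamma μ * (Real.cos β ^ (-μ) * ρ ^ (-μ)) +
          ρ * (C * Real.Gamma (μ + 1) * (Real.cos β ^ (-(μ + 1)) * ρ ^ (-(μ + 1)))) := by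
          gcongr
          · exact (norm_laplaceLog_le hμ hb hre).trans (by gcongr; exact hpow μ hμ)
          · exact (norm_deriv_laplaceLog_le hD.aestronglyMeasurable hμ hb hre).trans
              (by gcongr; exact hpow (μ + 1) (by linarith))
      _ = C * Real.Gamma μ * Real.cos β ^ (-μ) * ρ ^ (-μ) +
          C * Real.Gamma (μ + 1) * Real.cos β ^ (-(μ + 1)) * (ρ * ρ ^ (-(μ + 1))) := by ring
      _ = _ := by rw [hρpow]; ring

/-- The exponential `e^{-w e^u}`, an elementary solution with complex frequency `e^u`. -/
noncomputable def expAtom (u w : ℂ) : ℂ := exp (-(w * exp u))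

theorem hasDerivAt_expAtom (u w : ℂ) :
    HasDerivAt (expAtom u) (-exp u * expAtom u w) w := by
  convert! ((hasDerivAt_id w).mul_const (exp u)).neg.cexp using 1
  simp only [expAtom, id, Pi.neg_apply]
  ring

theorem exists_mul_exp_neg_le_rpow {c : ℝ} (hc : 0 < c) (μ : ℝ) :
    ∃ C, 0 ≤ C ∧ ∀ ρ : ℝ, 1 ≤ ρ → (1 + ρ) * Real.exp (-(c * ρ)) ≤ C * ρ ^ (-μ) := by
  obtain ⟨m, hm⟩ := exists_nat_ge (μ + 1)
  refine ⟨2 * (m.factorial / c ^ m), by positivity, fun ρ hρ => ?_⟩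
  have hρ0 : 0 < ρ := by linarith
  have hexp : Real.exp (-(c * ρ)) ≤ m.factorial / (c * ρ) ^ m := by
    rw [Real.exp_neg, ← inv_div]
    exact inv_anti₀ (by positivity) (Real.pow_div_factorial_le_exp _ (by positivity) m)
  calc (1 + ρ) * Real.exp (-(c * ρ)) ≤ 2 * ρ * (m.factorial / (c * ρ) ^ m) := by
        gcongr; linarith
    _ = 2 * (m.factorial / c ^ m) * (ρ * (ρ ^ m)⁻¹) := by rw [mul_pow]; field_simp
    _ ≤ 2 * (m.factorial / c ^ m) * (ρ * ρ ^ (-(μ + 1))) := by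
        rw [← Real.rpow_natCast ρ m, ← Real.rpow_neg hρ0.le]
        gcongr
    _ = _ := by rw [mul_comm ρ, ← Real.rpow_add_one hρ0.ne']; ring_nf

theorem isDecayingProfile_expAtom {φ : ℝ} (hβ : 0 ≤ β) (hφ : |φ| + β < π / 2) (μ : ℝ) :
    IsDecayingProfile β μ (expAtom (φ * I)) where
  differentiableAt w _ := (hasDerivAt_expAtom _ w).differentiableAt
  continuousOn := (continuous_iff_continuousAt.2 fun w =>
    (hasDerivAt_expAtom _ w).continuousAt).continuousOn
  decay := by
    have hcos : 0 < Real.cos (|φ| + β) :=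
      Real.cos_pos_of_mem_Ioo ⟨by linarith [abs_nonneg φ], hφ⟩
    obtain ⟨C, hC, h⟩ := exists_mul_exp_neg_le_rpow hcos μ
    refine ⟨C, hC, fun ρ θ hρ hθ => ?_⟩
    have hmul : (ρ : ℂ) * exp (θ * I) * exp (φ * I) = ρ * exp ((θ + φ : ℝ) * I) := by
      rw [mul_assoc, ← exp_add]
      push_cast
      ring_nf
    have hnorm : ‖expAtom (φ * I) (ρ * exp (θ * I))‖ ≤ Real.exp (-(Real.cos (|φ| + β) * ρ)) := by
      rw [expAtom, norm_exp, hmul, neg_re, re_polar, Real.exp_le_exp, neg_le_neg_iff, mul_comm]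
      refine mul_le_mul_of_nonneg_left (cos_le_cos_of_abs_le hφ ?_) (by linarith)
      exact (abs_add_le _ _).trans (by linarith)
    rw [(hasDerivAt_expAtom _ _).deriv, norm_mul, norm_neg, norm_exp_ofReal_mul_I, one_mul,
      ← one_add_mul]
    exact (mul_le_mul_of_nonneg_left hnorm (by linarith)).trans (h ρ hρ)

end DecayingProfile

section RobinDefect

open Complex MeasureTheory
open scoped Real

/-- The defect of `f` in the Robin condition for `w ↦ f w + ε f (conj w)` on the ray `arg w = β`. -/
noncomputable def robinDefect (β : ℝ) (ε : ℂ) (t : ℝ) (f : ℂ → ℂ) : ℂ :=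
  I * exp (β * I) * deriv f (t * exp (β * I)) - f (t * exp (β * I)) -
    ε * (f (t * exp (-(β * I))) + I * exp (-(β * I)) * deriv f (t * exp (-(β * I))))

variable {β t : ℝ} {ε : ℂ} {f g : ℂ → ℂ}

theorem re_ray_pos (hβ : |β| < π / 2) (ht : 0 < t) :
    0 < (t * exp (β * I)).re ∧ 0 < (t * exp (-(β * I))).re := by
  refine ⟨re_polar_pos ht hβ, ?_⟩
  simpa using re_polar_pos ht (by rwa [abs_neg] : |-β| < π / 2)

theorem robinDefect_add (hβ : |β| < π / 2) (ht : 0 < t)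
    (hf : ∀ w : ℂ, 0 < w.re → DifferentiableAt ℂ f w)
    (hg : ∀ w : ℂ, 0 < w.re → DifferentiableAt ℂ g w) :
    robinDefect β ε t (fun w => f w + g w) = robinDefect β ε t f + robinDefect β ε t g := by
  obtain ⟨hre, hre'⟩ := re_ray_pos hβ ht
  have hderiv (w : ℂ) (hw : 0 < w.re) : deriv (fun w => f w + g w) w = deriv f w + deriv g w :=
    deriv_add (hf w hw) (hg w hw)
  simp only [robinDefect]
  rw [hderiv _ hre, hderiv _ hre']
  ring

theorem robinDefect_const_mul (hβ : |β| < π / 2) (ht : 0 < t)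
    (hf : ∀ w : ℂ, 0 < w.re → DifferentiableAt ℂ f w) (c : ℂ) :
    robinDefect β ε t (fun w => c * f w) = c * robinDefect β ε t f := by
  obtain ⟨hre, hre'⟩ := re_ray_pos hβ ht
  simp only [robinDefect]
  rw [deriv_const_mul _ (hf _ hre), deriv_const_mul _ (hf _ hre')]
  ring

theorem robinDefect_expAtom (u : ℂ) :
    robinDefect β ε t (expAtom u) =
      -((1 + I * exp (u + I * β)) * exp (-(t * exp (u + I * β)))) -
        ε * ((1 - I * exp (u - I * β)) * exp (-(t * exp (u - I * β)))) := by
  have hadd : exp (u + I * β) = exp (β * I) * exp u := by rw [← exp_add]; ring_nf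
  have hsub : exp (u - I * β) = exp (-(β * I)) * exp u := by rw [← exp_add]; ring_nf
  simp only [robinDefect, (hasDerivAt_expAtom _ _).deriv, hadd, hsub, expAtom, mul_assoc]
  ring

theorem robinDefect_laplaceLog (hβ : |β| < π / 2) (ht : 0 < t) {D : ℝ → ℂ} {C s : ℝ}
    (hD : AEStronglyMeasurable D) (hs : 0 < s) (hb : ∀ x, ‖D x‖ ≤ C * Real.exp (s * x)) :
    robinDefect β ε t (laplaceLog D) = ∫ x : ℝ, D x * robinDefect β ε t (expAtom x) := by
  obtain ⟨hre, hre'⟩ := re_ray_pos hβ ht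
  have hint {w : ℂ} (hw : 0 < w.re) := integrable_exp_neg_mul_exp_mul hD hs hb hw
  have hint' {w : ℂ} (hw : 0 < w.re) :
      Integrable fun x : ℝ => exp (-(w * Real.exp x)) * (Real.exp x * D x) :=
    integrable_exp_neg_mul_exp_mul (.mul (Continuous.aestronglyMeasurable (by fun_prop)) hD)
      (by linarith) (norm_exp_mul_le hb) hw
  have hpoint (x : ℝ) : D x * robinDefect β ε t (expAtom x) =
      -(I * exp (β * I)) * (exp (-(t * exp (β * I) * Real.exp x)) * (Real.exp x * D x)) -
        exp (-(t * exp (β * I) * Real.exp x)) * D x -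
      ε * (exp (-(t * exp (-(β * I)) * Real.exp x)) * D x + -(I * exp (-(β * I))) *
        (exp (-(t * exp (-(β * I)) * Real.exp x)) * (Real.exp x * D x))) := by
    simp only [robinDefect, (hasDerivAt_expAtom _ _).deriv, expAtom, ofReal_exp]
    ring
  simp only [hpoint]
  rw [integral_sub (((hint' hre).const_mul _).sub' (hint hre))
      (((hint hre').fun_add ((hint' hre').const_mul _)).const_mul _),
    integral_sub ((hint' hre).const_mul _) (hint hre), integral_const_mul, integral_const_mul,
    integral_add (hint hre') ((hint' hre').const_mul _), integral_const_mul,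
    robinDefect, (hasDerivAt_laplaceLog hD hs hb hre).deriv,
    (hasDerivAt_laplaceLog hD hs hb hre').deriv]
  simp only [laplaceLog]
  ring

end RobinDefect

section EdgeAmplitude

open Complex Filter Topology MeasureTheory Set
open scoped Real

/-- The exponential `e^{πv/β}`, of period `2iβ` and antiperiod `iβ`. -/
noncomputable def stripExp (β : ℝ) (v : ℂ) : ℂ := exp (π / β * v)

/-- The amplitude given to the exponential `e^{-w e^u}` in an edge wave; the factor `e^{pπu/β}`
tunes its growth and the sign of the functional equation `edgeUpper_eq_edgeLower`. -/
noncomputable def edgeAmp (β p : ℝ) (u : ℂ) : ℂ :=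
  exp (malyuzhinetsLog β u + p * (π / β) * u)

/-- Minus the part of the Robin defect of `edgeAmp β p u * expAtom u` that comes from the side
`arg w = β`, as a function of `v = u + iβ`. -/
noncomputable def edgeUpper (β p t : ℝ) (v : ℂ) : ℂ :=
  (1 + I * exp v) * edgeAmp β p (v - I * β) * exp (-(t * exp v))

/-- The part of the Robin defect of `edgeAmp β p u * expAtom u` that comes from the side
`arg w = -β`, as a function of `v = u - iβ`. -/
noncomputable def edgeLower (β p : ℝ) (ε : ℂ) (t : ℝ) (v : ℂ) : ℂ :=
  -ε * (1 - I * exp v) * edgeAmp β p (v + I * β) * exp (-(t * exp v))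

variable {β p t : ℝ} {ε : ℂ}

theorem differentiableAt_edgeAmp (hβ : 0 < β) {u : ℂ} (hu : |u.im| < β + π / 2) :
    DifferentiableAt ℂ (edgeAmp β p) u :=
  ((differentiableAt_malyuzhinetsLog hβ hu).add (by fun_prop)).cexp

theorem edgeUpper_eq_edgeLower (hβ : 0 < β) (hε : ε * I * exp (2 * π * p * I) = 1) {v : ℂ}
    (hv : |v.im| < π / 2) : edgeUpper β p t v = edgeLower β p ε t v := by
  have hβc : (β : ℂ) ≠ 0 := ofReal_ne_zero.2 hβ.ne'
  have hshift : edgeAmp β p (v + I * β) =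
      edgeAmp β p (v - I * β) * exp (I * gudermannian v) * exp (2 * π * p * I) := by
    rw [← malyuzhinetsLog_add_sub hβ hv, edgeAmp, edgeAmp, ← exp_add, ← exp_add]
    congr 1
    field_simp
    ring
  rw [edgeUpper, edgeLower, hshift]
  linear_combination (-(1 + I * exp v) * edgeAmp β p (v - I * β) * exp (-(t * exp v))) * hε +
    (ε * edgeAmp β p (v - I * β) * exp (2 * π * p * I) * exp (-(t * exp v))) *
      exp_I_mul_gudermannian hv

theorem edgeAmp_mul_robinDefect (u : ℂ) :
    edgeAmp β p u * robinDefect β ε t (expAtom u) =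
      edgeLower β p ε t (u - I * β) - edgeUpper β p t (u + I * β) := by
  rw [robinDefect_expAtom, edgeLower, edgeUpper, sub_add_cancel, add_sub_cancel_right]
  ring

theorem differentiableAt_edgeUpper (hβ : 0 < β) {v : ℂ} (hv : |v.im - β| < β + π / 2) :
    DifferentiableAt ℂ (edgeUpper β p t) v := by
  have hamp : DifferentiableAt ℂ (fun v => edgeAmp β p (v - I * β)) v :=
    (differentiableAt_edgeAmp hβ (by simpa using hv)).comp (g := edgeAmp β p) v (by fun_prop)
  unfold edgeUpper
  fun_prop

theorem norm_edgeAmp (u : ℂ) :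
    ‖edgeAmp β p u‖ = Real.exp ((malyuzhinetsLog β u).re + p * (π / β) * u.re) := by
  rw [edgeAmp, norm_exp, add_re, ← ofReal_div, ← ofReal_mul, re_ofReal_mul]

theorem exists_norm_edgeAmp_le (hβ : 0 < β) (hβ' : β < π / 2) : ∃ C : ℝ, ∀ x y : ℝ,
    |y| ≤ 2 * β → ‖edgeAmp β p (x + y * I)‖ ≤
      Real.exp (π / (4 * β) * |x| + C + p * (π / β) * x) := by
  obtain ⟨C, hC⟩ := exists_re_malyuzhinetsLog_le hβ (by linarith : 2 * β < β + π / 2)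
  refine ⟨C, fun x y hy => ?_⟩
  rw [norm_edgeAmp, show ((x : ℂ) + y * I).re = x by simp]
  gcongr
  exact hC x y hy

theorem norm_edgeAmp_ofReal_le (hβ : 0 < β) (x : ℝ) :
    ‖edgeAmp β p x‖ ≤ Real.exp (π / (4 * β) * |x| + p * (π / β) * x) := by
  rw [norm_edgeAmp, ofReal_re]
  gcongr
  exact re_malyuzhinetsLog_ofReal_le hβ x

theorem one_add_exp_mul_exp_neg_mul_exp_le {a c x : ℝ} (hc : 0 < c)
    (hx : 2 * (2 * a + 1) / c ≤ |x|) :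
    (1 + Real.exp x) * Real.exp (-(c * Real.exp x)) ≤ 2 * Real.exp (-a * (|x| + x)) := by
  rcases le_total 0 x with h | h
  · rw [abs_of_nonneg h] at hx ⊢
    have hlin : (2 * a + 1) * x ≤ c * Real.exp x := by
      rw [div_le_iff₀ hc] at hx
      calc (2 * a + 1) * x = (2 * (2 * a + 1)) * (x / 2) := by ring
        _ ≤ x * c * (x / 2) := by gcongr
        _ = c * (x ^ 2 / 2) := by ring
        _ ≤ c * Real.exp x := by
          gcongr
          linarith [Real.quadratic_le_exp_of_nonneg h]
    calc _ ≤ 2 * Real.exp x * Real.exp (-((2 * a + 1) * x)) := by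
          gcongr
          linarith [Real.one_le_exp h]
      _ = _ := by rw [mul_assoc, ← Real.exp_add]; ring_nf
  · rw [abs_of_nonpos h, neg_add_cancel, mul_zero, Real.exp_zero]
    calc _ ≤ (1 + 1) * (1 : ℝ) := by
          gcongr
          · exact Real.exp_le_one_iff.2 h
          · exact Real.exp_le_one_iff.2 (neg_nonpos.2 (by positivity))
      _ = 2 * 1 := by norm_num

theorem norm_exp_neg_mul_exp_add_mul_I_le {y : ℝ} (hβ : β < π / 2) (ht : 0 ≤ t) (hy : |y| ≤ β)
    (x : ℝ) : ‖exp (-(t * exp (x + y * I)))‖ ≤ Real.exp (-(t * Real.cos β * Real.exp x)) := by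
  rw [norm_exp, neg_re, re_ofReal_mul, exp_add, ← ofReal_exp, re_polar, mul_assoc,
    mul_comm (Real.cos β)]
  gcongr
  exact cos_le_cos_of_abs_le hβ hy

theorem exists_norm_edgeUpper_le (hβ : 0 < β) (hβ' : β < π / 2) (ht : 0 < t) :
    ∃ C X : ℝ, ∀ x y : ℝ, |y| ≤ β → X ≤ |x| →
      ‖edgeUpper β p t (x + y * I)‖ ≤ C * Real.exp (-((p - 1 / 4) * (π / β)) * |x|) := by
  obtain ⟨C, hC⟩ := exists_norm_edgeAmp_le (p := p) hβ hβ'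
  have hcos : 0 < Real.cos β := Real.cos_pos_of_mem_Ioo ⟨by linarith, hβ'⟩
  set a := p * (π / β)
  refine ⟨2 * Real.exp C, 2 * (2 * a + 1) / (t * Real.cos β), fun x y hy hx => ?_⟩
  have hy' : |y - β| ≤ 2 * β := by
    rw [abs_le] at hy ⊢
    constructor <;> linarith
  have hamp := hC x (y - β) hy'
  rw [ofReal_sub, sub_mul, mul_comm (β : ℂ), ← add_sub_assoc] at hamp
  have hfactor : ‖1 + I * exp ((x : ℂ) + y * I)‖ ≤ 1 + Real.exp x :=
    (norm_add_le _ _).trans (by simp [norm_exp])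
  have hgauss := norm_exp_neg_mul_exp_add_mul_I_le hβ' ht.le hy x
  rw [edgeUpper, norm_mul, norm_mul]
  calc _ ≤ (1 + Real.exp x) * Real.exp (π / (4 * β) * |x| + C + a * x) *
        Real.exp (-(t * Real.cos β * Real.exp x)) := by gcongr
    _ = (1 + Real.exp x) * Real.exp (-(t * Real.cos β * Real.exp x)) *
        Real.exp (π / (4 * β) * |x| + C + a * x) := by ring
    _ ≤ 2 * Real.exp (-a * (|x| + x)) * Real.exp (π / (4 * β) * |x| + C + a * x) := by
      gcongr ?_ * _
      exact one_add_exp_mul_exp_neg_mul_exp_le (by positivity) hx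
    _ = _ := by
      rw [mul_assoc, ← Real.exp_add, mul_assoc (2 : ℝ) (Real.exp C), ← Real.exp_add]
      congr 2
      simp only [a]
      field_simp
      ring

end EdgeAmplitude

section EdgeDensity

open Complex Filter Topology MeasureTheory Set
open scoped Real

variable {β p t s : ℝ} {ε : ℂ}

theorem hasDerivAt_stripExp (β : ℝ) (v : ℂ) :
    HasDerivAt (stripExp β) (stripExp β v * (π / β)) v := by
  convert! ((hasDerivAt_id v).const_mul ((π : ℂ) / β)).cexp using 1
  simp only [stripExp, id, mul_one]

theorem norm_stripExp (β : ℝ) (v : ℂ) : ‖stripExp β v‖ = Real.exp (π / β * v.re) := by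
  rw [stripExp, norm_exp, ← ofReal_div, re_ofReal_mul]

theorem norm_stripExp_ofReal_mul_I (β s : ℝ) : ‖stripExp β (s * I)‖ = 1 := by
  simp [norm_stripExp]

theorem stripExp_ofReal (β x : ℝ) : stripExp β x = (Real.exp (π / β * x) : ℝ) := by
  simp [stripExp]

theorem stripExp_neg (β : ℝ) (v : ℂ) : stripExp β (-v) = (stripExp β v)⁻¹ := by
  rw [stripExp, stripExp, mul_neg, exp_neg]

theorem stripExp_add_odd_mul (hβ : β ≠ 0) (v : ℂ) (k : ℤ) :
    stripExp β (v + ((2 * k + 1) * β : ℝ) * I) = -stripExp β v := by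
  have hβc : (β : ℂ) ≠ 0 := ofReal_ne_zero.2 hβ
  have hexp : (π : ℂ) / β * (v + ((2 * k + 1) * β : ℝ) * I) =
      π / β * v + π * I + k * (2 * π * I) := by
    push_cast
    field_simp
    ring
  rw [stripExp, stripExp, hexp, exp_add, exp_add, exp_pi_mul_I, exp_int_mul_two_pi_mul_I]
  ring

theorem stripExp_add_of_abs_eq (hβ : 0 < β) {σ : ℝ} (hσ : |σ| = β) (v : ℂ) :
    stripExp β (v + σ * I) = -stripExp β v := by
  rcases (abs_eq hβ.le).1 hσ with rfl | rfl
  · simpa using stripExp_add_odd_mul hβ.ne' v 0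
  · rw [← stripExp_add_odd_mul hβ.ne' v (-1)]
    push_cast
    ring_nf

theorem eq_of_stripExp_eq (hβ : 0 < β) (hs : |s| < β) {v : ℂ} (hv : |v.im| ≤ β)
    (h : stripExp β v = stripExp β (s * I)) : v = s * I := by
  have hβc : (β : ℂ) ≠ 0 := ofReal_ne_zero.2 hβ.ne'
  have hπc : (π : ℂ) ≠ 0 := ofReal_ne_zero.2 Real.pi_ne_zero
  obtain ⟨k, hk⟩ := exp_eq_exp_iff_exists_int.1 h
  have hv' : v = ((s + k * (2 * β) : ℝ) : ℂ) * I := by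
    refine mul_left_cancel₀ (div_ne_zero hπc hβc) (hk.trans ?_)
    push_cast
    field_simp
  have him : v.im = s + k * (2 * β) := by rw [hv', im_ofReal_mul, I_im, mul_one]
  rw [him] at hv
  rw [abs_lt] at hs
  rw [abs_le] at hv
  have hk_lt : (k : ℝ) < 1 := by by_contra!; nlinarith
  have hlt_k : (-1 : ℝ) < k := by by_contra!; nlinarith
  obtain rfl : k = 0 := by
    have : k < 1 := by exact_mod_cast hk_lt
    have : -1 < k := by exact_mod_cast hlt_k
    omega
  simpa using hv'

theorem one_add_stripExp_ne_zero (hβ : 0 < β) (hs : |s| < β) : 1 + stripExp β (s * I) ≠ 0 := by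
  intro h
  have hβI : stripExp β (β * I) = -1 := by
    simpa [stripExp] using stripExp_add_odd_mul hβ.ne' 0 0
  have heq := eq_of_stripExp_eq hβ hs (v := β * I) (by simp [abs_of_pos hβ])
    (by linear_combination hβI - h)
  have : β = s := by simpa using heq
  exact absurd hs (by rw [← this, abs_of_pos hβ]; exact lt_irrefl β)

theorem norm_one_add_div_two_mul_le {z : ℂ} (hz : ‖z‖ = 1) (Y : ℝ) :
    ‖1 + z‖ / 2 * (1 + Y) ≤ ‖(Y : ℂ) + z‖ := by
  have hz' : z.re ^ 2 + z.im ^ 2 = 1 := by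
    have := Complex.sq_norm_sub_sq_re z
    rw [hz] at this
    linarith
  have hnorm (Y : ℝ) : ‖(Y : ℂ) + z‖ ^ 2 = (Y + z.re) ^ 2 + z.im ^ 2 := by
    have := Complex.sq_norm_sub_sq_re (Y + z)
    simp only [add_re, ofReal_re, add_im, ofReal_im, zero_add] at this
    linarith
  refine le_of_sq_le_sq ?_ (norm_nonneg _)
  rw [hnorm, mul_pow, div_pow, ← ofReal_one, hnorm]
  have hre : 0 ≤ 1 - z.re := by nlinarith [sq_nonneg z.im]
  nlinarith [mul_nonneg hre (sq_nonneg (1 - Y))]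

theorem stripExp_ofReal_add_ne_zero (hβ : 0 < β) (hs : |s| < β) (x : ℝ) :
    stripExp β x + stripExp β (s * I) ≠ 0 := by
  have hz := one_add_stripExp_ne_zero hβ hs
  rw [stripExp_ofReal, ← norm_pos_iff]
  exact lt_of_lt_of_le (by positivity)
    (norm_one_add_div_two_mul_le (norm_stripExp_ofReal_mul_I β s) _)

theorem half_le_norm_stripExp_sub (hβ : 0 < β) {z v : ℂ} (hz : ‖z‖ = 1) (hv : β ≤ |v.re|) :
    1 / 2 ≤ ‖stripExp β v - z‖ := by
  have habs := abs_norm_sub_norm_le (stripExp β v) z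
  rw [hz, norm_stripExp] at habs
  refine le_trans ?_ habs
  have hπ := Real.pi_gt_three
  have hlarge : π ≤ |π / β * v.re| := by
    rw [abs_mul, abs_of_pos (by positivity), div_mul_eq_mul_div, le_div_iff₀ hβ]
    gcongr
  rcases le_abs.1 hlarge with h | h
  · rw [le_abs]
    exact .inl (by linarith [Real.add_one_le_exp (π / β * v.re)])
  · rw [le_abs]
    right
    have hinv := Real.add_one_le_exp (-(π / β * v.re))
    rw [Real.exp_neg] at hinv
    have hsmall : Real.exp (π / β * v.re) ≤ 2⁻¹ :=
      (le_inv_comm₀ (by norm_num) (Real.exp_pos _)).1 (by linarith)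
    linarith

theorem exists_norm_edgeUpper_div_le (hβ : 0 < β) (hβ' : β < π / 2) (ht : 0 < t)
    (s : ℝ) : ∃ C X : ℝ, ∀ x y : ℝ, -β ≤ y → y ≤ β → X ≤ |x| →
      ‖edgeUpper β p t (x + y * I) / (stripExp β (x + y * I) - stripExp β (s * I))‖ ≤
        C * Real.exp (-((p - 1 / 4) * (π / β)) * |x|) := by
  obtain ⟨C, X, hC⟩ := exists_norm_edgeUpper_le hβ hβ' ht
  refine ⟨2 * C, max X β, fun x y hy hy' hx => ?_⟩
  have hden := half_le_norm_stripExp_sub hβ (v := x + y * I) (norm_stripExp_ofReal_mul_I β s)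
    (by simpa using (le_max_right X β).trans hx)
  have hnum := hC x y (abs_le.2 ⟨hy, hy'⟩) ((le_max_left X β).trans hx)
  rw [norm_div, div_le_iff₀ (one_half_pos.trans_le hden)]
  calc _ ≤ C * Real.exp (-((p - 1 / 4) * (π / β)) * |x|) := hnum
    _ = 2 * (C * Real.exp (-((p - 1 / 4) * (π / β)) * |x|)) * (1 / 2) := by ring
    _ ≤ 2 * (C * Real.exp (-((p - 1 / 4) * (π / β)) * |x|)) *
        ‖stripExp β (x + y * I) - stripExp β (s * I)‖ := by
      have := (norm_nonneg _).trans hnum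
      gcongr
    _ = _ := by ring

theorem integrable_edgeUpper_div (hβ : 0 < β) (hβ' : β < π / 2) (ht : 0 < t) (hp : 1 / 4 < p)
    (hs : |s| < β) {σ : ℝ} (hσ : |σ| = β) :
    Integrable fun x : ℝ =>
      edgeUpper β p t (x + σ * I) / (stripExp β x + stripExp β (s * I)) := by
  obtain ⟨C, X, hdecay⟩ := exists_norm_edgeUpper_div_le hβ hβ' ht s (p := p)
  obtain ⟨hσ_ge, hσ_le⟩ := abs_le.1 hσ.le
  have hcont : Continuous fun x : ℝ => edgeUpper β p t (x + σ * I) := by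
    refine continuous_iff_continuousAt.2 fun x => ?_
    have him : ((x : ℂ) + σ * I).im = σ := by simp
    have hdiff := differentiableAt_edgeUpper (p := p) (t := t) hβ (v := x + σ * I) (by
      rw [him, abs_lt]
      constructor <;> linarith)
    exact hdiff.continuousAt.comp (f := fun x : ℝ => (x : ℂ) + σ * I) (by fun_prop)
  have hden : Continuous fun x : ℝ => stripExp β x + stripExp β (s * I) := by
    simp only [stripExp_ofReal]
    fun_prop
  refine integrable_of_continuous_of_norm_le_exp
    (hcont.div hden (stripExp_ofReal_add_ne_zero hβ hs)) (δ := (p - 1 / 4) * (π / β))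
    (mul_pos (by linarith) (by positivity)) (C := C) (X := X) fun x hx => ?_
  have h := hdecay x σ hσ_ge hσ_le hx
  rwa [stripExp_add_of_abs_eq hβ hσ, ← neg_add', norm_div, norm_neg, ← norm_div] at h

theorem integral_edgeUpper_div_sub (hβ : 0 < β) (hβ' : β < π / 2) (ht : 0 < t) (hp : 1 / 4 < p)
    (hs : |s| < β) :
    (∫ x : ℝ, edgeUpper β p t (x + (-β : ℝ) * I) / (stripExp β x + stripExp β (s * I))) -
      (∫ x : ℝ, edgeUpper β p t (x + β * I) / (stripExp β x + stripExp β (s * I))) =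
      -(2 * I * β / stripExp β (s * I) * edgeUpper β p t (s * I)) := by
  have hβc : (β : ℂ) ≠ 0 := ofReal_ne_zero.2 hβ.ne'
  have hπc : (π : ℂ) ≠ 0 := ofReal_ne_zero.2 Real.pi_ne_zero
  have hE : stripExp β (s * I) ≠ 0 := exp_ne_zero _
  obtain ⟨C, X, hdecay⟩ := exists_norm_edgeUpper_div_le hβ hβ' ht s (p := p)
  have hderiv (v : ℂ) : HasDerivAt (fun v => stripExp β v - stripExp β (s * I))
      (stripExp β v * (π / β)) v := (hasDerivAt_stripExp β v).sub_const _
  have hside {σ : ℝ} (hσ : |σ| = β) (x : ℝ) : stripExp β (x + σ * I) - stripExp β (s * I) =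
      -(stripExp β x + stripExp β (s * I)) := by
    rw [stripExp_add_of_abs_eq hβ hσ]
    ring
  have hresidue := integral_div_sub_integral_div_of_simple_zero_in_strip (v₀ := s * I)
    (g := edgeUpper β p t) (D := fun v => stripExp β v - stripExp β (s * I))
    (by simpa using (abs_lt.1 hs).1) (by simpa using (abs_lt.1 hs).2)
    (fun v hv => (differentiableAt_edgeUpper hβ (by
      rw [abs_lt]
      constructor <;> linarith [hv.1, hv.2])).differentiableWithinAt)
    (fun v => (hderiv v).differentiableAt) (sub_self _)
    (by
      rw [(hderiv _).deriv]
      exact mul_ne_zero hE (div_ne_zero hπc hβc))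
    (fun v hv hv' h => eq_of_stripExp_eq hβ hs (abs_le.2 ⟨hv, hv'⟩) (sub_eq_zero.1 h))
    (mul_pos (by linarith : 0 < p - 1 / 4) (by positivity : 0 < π / β)) hdecay
  simp only [hside (by rw [abs_neg, abs_of_pos hβ] : |-β| = β), hside (abs_of_pos hβ), div_neg,
    integral_neg, (hderiv _).deriv] at hresidue
  rw [← neg_inj, neg_sub', hresidue]
  field_simp

/-- The density of the Laplace integral in an edge wave: its two poles are placed symmetrically,
at the points of `|Im x| ≤ β` where `e^{πx/β} = -e^{±iπs/β}`. -/
noncomputable def edgeDensity (β p s : ℝ) (x : ℝ) : ℂ :=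
  edgeAmp β p x *
    (1 / (stripExp β x + stripExp β (s * I)) - 1 / (stripExp β x + stripExp β ((-s : ℝ) * I)))

theorem continuous_edgeDensity (hβ : 0 < β) (hs : |s| < β) : Continuous (edgeDensity β p s) := by
  have hamp : Continuous fun x : ℝ => edgeAmp β p x := continuous_iff_continuousAt.2 fun x =>
    (differentiableAt_edgeAmp (p := p) hβ (u := x) (by
      rw [ofReal_im, abs_zero]
      positivity)).continuousAt.comp
      (f := fun x : ℝ => (x : ℂ)) (by fun_prop)
  have hstrip : Continuous fun x : ℝ => stripExp β x := by
    simp only [stripExp_ofReal]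
    fun_prop
  have hs' : |-s| < β := by rwa [abs_neg]
  exact hamp.mul ((continuous_const.div (hstrip.add continuous_const)
    (stripExp_ofReal_add_ne_zero hβ hs)).sub (continuous_const.div (hstrip.add continuous_const)
    (stripExp_ofReal_add_ne_zero hβ hs')))

theorem exp_abs_add_mul_le {p q : ℝ} (hq : 0 ≤ q) (hp : 3 / 4 ≤ p) (hp' : p ≤ 5 / 4) (x : ℝ) :
    Real.exp (q / 4 * |x| + p * q * x) ≤
      Real.exp (-(q / 2) * |x|) * (1 + Real.exp (q * x)) ^ 2 := by
  rcases le_total 0 x with h | h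
  · have hqx : 0 ≤ q * x := mul_nonneg hq h
    rw [abs_of_nonneg h]
    calc _ ≤ Real.exp (-(q / 2) * x + (2 : ℕ) * (q * x)) := by
          rw [Real.exp_le_exp]
          push_cast
          nlinarith
      _ = Real.exp (-(q / 2) * x) * Real.exp (q * x) ^ 2 := by rw [Real.exp_add, Real.exp_nat_mul]
      _ ≤ _ := by gcongr; linarith
  · have hqx : 0 ≤ q * -x := mul_nonneg hq (by linarith)
    rw [abs_of_nonpos h]
    calc _ ≤ Real.exp (-(q / 2) * -x) := by gcongr; nlinarith
      _ ≤ _ := le_mul_of_one_le_right (Real.exp_pos _).le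
        (one_le_pow₀ (by linarith [Real.exp_pos (q * x)]))

theorem exists_norm_inv_sub_inv_le (hβ : 0 < β) (hs : |s| < β) : ∃ C, ∀ x : ℝ,
    ‖1 / (stripExp β x + stripExp β (s * I)) - 1 / (stripExp β x + stripExp β ((-s : ℝ) * I))‖ ≤
      C / (1 + Real.exp (π / β * x)) ^ 2 := by
  have hs' : |-s| < β := by rwa [abs_neg]
  have hc := norm_pos_iff.2 (one_add_stripExp_ne_zero hβ hs)
  have hc' := norm_pos_iff.2 (one_add_stripExp_ne_zero hβ hs')
  set c := ‖1 + stripExp β (s * I)‖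
  set c' := ‖1 + stripExp β ((-s : ℝ) * I)‖
  refine ⟨2 / (c / 2 * (c' / 2)), fun x => ?_⟩
  have hden := norm_one_add_div_two_mul_le (norm_stripExp_ofReal_mul_I β s)
    (Real.exp (π / β * x))
  have hden' := norm_one_add_div_two_mul_le (norm_stripExp_ofReal_mul_I β (-s))
    (Real.exp (π / β * x))
  rw [← stripExp_ofReal] at hden hden'
  rw [div_sub_div _ _ (stripExp_ofReal_add_ne_zero hβ hs x) (stripExp_ofReal_add_ne_zero hβ hs' x),
    norm_div, norm_mul, div_div]
  have hnum : ‖1 * (stripExp β x + stripExp β ((-s : ℝ) * I)) -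
      (stripExp β x + stripExp β (s * I)) * 1‖ ≤ 2 := by
    rw [one_mul, mul_one, add_sub_add_left_eq_sub]
    refine (norm_sub_le _ _).trans ?_
    rw [norm_stripExp_ofReal_mul_I, norm_stripExp_ofReal_mul_I]
    norm_num
  refine div_le_div₀ zero_le_two hnum (by positivity) ?_
  calc _ = (c / 2 * (1 + Real.exp (π / β * x))) * (c' / 2 * (1 + Real.exp (π / β * x))) := by ring
    _ ≤ _ := by gcongr

theorem exists_norm_edgeDensity_le (hβ : 0 < β) (hs : |s| < β) (hp : 3 / 4 ≤ p) (hp' : p ≤ 5 / 4) :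
    ∃ C, ∀ x, ‖edgeDensity β p s x‖ ≤ C * Real.exp (-(π / (2 * β)) * |x|) := by
  obtain ⟨C, hC⟩ := exists_norm_inv_sub_inv_le hβ hs
  refine ⟨C, fun x => ?_⟩
  have hamp := (norm_edgeAmp_ofReal_le (p := p) hβ x).trans
    ((congrArg Real.exp (by field_simp)).le.trans
      (exp_abs_add_mul_le (q := π / β) (by positivity) hp hp' x))
  rw [edgeDensity, norm_mul]
  calc _ ≤ Real.exp (-(π / β / 2) * |x|) * (1 + Real.exp (π / β * x)) ^ 2 *
        (C / (1 + Real.exp (π / β * x)) ^ 2) := by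
        gcongr
        exact hC x
    _ = C * Real.exp (-(π / β / 2) * |x|) := by field_simp
    _ = _ := by rw [div_div, mul_comm β]

theorem integrable_edgeDensity (hβ : 0 < β) (hs : |s| < β) (hp : 3 / 4 ≤ p) (hp' : p ≤ 5 / 4) :
    Integrable (edgeDensity β p s) := by
  obtain ⟨C, hC⟩ := exists_norm_edgeDensity_le hβ hs hp hp'
  exact integrable_of_continuous_of_norm_le_exp (continuous_edgeDensity hβ hs)
    (by positivity : 0 < π / (2 * β)) (X := 0) fun x _ => hC x

theorem exists_norm_edgeDensity_le_exp_mul (hβ : 0 < β) (hs : |s| < β) (hp : 3 / 4 ≤ p)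
    (hp' : p ≤ 5 / 4) : ∃ C, ∀ x, ‖edgeDensity β p s x‖ ≤ C * Real.exp (π / (2 * β) * x) := by
  obtain ⟨C, hC⟩ := exists_norm_edgeDensity_le hβ hs hp hp'
  have hC0 : 0 ≤ C := by simpa using (norm_nonneg _).trans (hC 0)
  refine ⟨C, fun x => (hC x).trans ?_⟩
  rw [neg_mul, ← mul_neg]
  gcongr
  exact neg_abs_le x

theorem robinDefect_laplaceLog_edgeDensity (hβ : 0 < β) (hβ' : β < π / 2) (ht : 0 < t)
    (hp : 3 / 4 ≤ p) (hp' : p ≤ 5 / 4) (hε : ε * I * exp (2 * π * p * I) = 1) (hs : |s| < β) :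
    robinDefect β ε t (laplaceLog (edgeDensity β p s)) =
      2 * I * β / stripExp β ((-s : ℝ) * I) * edgeUpper β p t ((-s : ℝ) * I) -
        2 * I * β / stripExp β (s * I) * edgeUpper β p t (s * I) := by
  obtain ⟨C, hC⟩ := exists_norm_edgeDensity_le_exp_mul hβ hs hp hp'
  have hs' : |-s| < β := by rwa [abs_neg]
  have hp4 : 1 / 4 < p := by linarith
  have hlo : |-β| = β := by rw [abs_neg, abs_of_pos hβ]
  have hint {s σ : ℝ} (hs : |s| < β) (hσ : |σ| = β) :=
    integrable_edgeUpper_div hβ hβ' ht hp4 hs hσ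
  have hpoint (x : ℝ) : edgeAmp β p x * robinDefect β ε t (expAtom x) =
      edgeUpper β p t (x + (-β : ℝ) * I) - edgeUpper β p t (x + β * I) := by
    rw [edgeAmp_mul_robinDefect,
      ← edgeUpper_eq_edgeLower hβ hε (by simpa [abs_of_pos hβ] using hβ')]
    push_cast
    ring_nf
  rw [robinDefect_laplaceLog (by rwa [abs_of_pos hβ]) ht
    (continuous_edgeDensity hβ hs).aestronglyMeasurable (by positivity) hC]
  trans -(2 * I * β / stripExp β (s * I) * edgeUpper β p t (s * I)) -
    -(2 * I * β / stripExp β ((-s : ℝ) * I) * edgeUpper β p t ((-s : ℝ) * I))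
  · rw [← integral_edgeUpper_div_sub hβ hβ' ht hp4 hs,
      ← integral_edgeUpper_div_sub hβ hβ' ht hp4 hs',
      ← integral_sub (hint hs hlo) (hint hs (abs_of_pos hβ)),
      ← integral_sub (hint hs' hlo) (hint hs' (abs_of_pos hβ)),
      ← integral_sub ((hint hs hlo).sub' (hint hs (abs_of_pos hβ)))
        ((hint hs' hlo).sub' (hint hs' (abs_of_pos hβ)))]
    congr 1 with x
    rw [edgeDensity]
    linear_combination (1 / (stripExp β x + stripExp β (s * I)) -
      1 / (stripExp β x + stripExp β ((-s : ℝ) * I))) * hpoint x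
  · ring

end EdgeDensity

section EdgeProfile

open Complex Filter Topology MeasureTheory Set
open scoped Real

/-- The sum of the `n` exponentials `e^{-w e^u}`, weighted by their edge amplitudes, at the points
`u = iφ, i(φ - 2β), i(φ - 4β), …`. -/
noncomputable def expLadder (β p φ : ℝ) (n : ℕ) (w : ℂ) : ℂ :=
  ∑ j ∈ Finset.range n, edgeAmp β p ((φ - 2 * j * β : ℝ) * I) *
    expAtom ((φ - 2 * j * β : ℝ) * I) w

variable {β p φ t : ℝ} {ε : ℂ} {n : ℕ}

theorem differentiable_expLadder (β p φ : ℝ) (n : ℕ) : Differentiable ℂ (expLadder β p φ n) :=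
  fun w => DifferentiableAt.fun_sum fun _ _ =>
    (hasDerivAt_expAtom _ w).differentiableAt.const_mul _

theorem expLadder_succ (w : ℂ) : expLadder β p φ (n + 1) w =
    expLadder β p φ n w + edgeAmp β p ((φ - 2 * n * β : ℝ) * I) *
      expAtom ((φ - 2 * n * β : ℝ) * I) w :=
  Finset.sum_range_succ _ n

theorem expLadder_succ' (w : ℂ) : expLadder β p φ (n + 1) w =
    edgeAmp β p (φ * I) * expAtom (φ * I) w + expLadder β p (φ - 2 * β) n w := by
  rw [expLadder, Finset.sum_range_succ', add_comm, expLadder]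
  congr 1
  · simp
  · refine Finset.sum_congr rfl fun j _ => ?_
    push_cast
    ring_nf

theorem isDecayingProfile_expLadder (hβ : 0 < β) (hβ' : β < π / 2) (hφ : φ + β < π / 2)
    (hn : (2 * n - 1) * β < φ + π / 2) (μ : ℝ) : IsDecayingProfile β μ (expLadder β p φ n) := by
  refine .sum hβ' _ fun j hj => (isDecayingProfile_expAtom hβ.le ?_ μ).const_mul hβ' _
  have hj0 : 0 ≤ j * β := by positivity
  have hjn : (j + 1) * β ≤ n * β := by
    gcongr
    exact_mod_cast Finset.mem_range.1 hj
  rw [← lt_sub_iff_add_lt, abs_lt]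
  constructor <;> linarith

theorem robinDefect_expLadder_succ (hβ : 0 < β) (hβ' : β < π / 2) (ht : 0 < t)
    (hε : ε * I * exp (2 * π * p * I) = 1) (hφ : φ < β + π / 2)
    (hn : (2 * n - 1) * β < φ + π / 2) :
    robinDefect β ε t (expLadder β p φ (n + 1)) =
      edgeLower β p ε t ((φ - (2 * n + 1) * β : ℝ) * I) - edgeUpper β p t ((φ + β : ℝ) * I) := by
  have habs : |β| < π / 2 := by rwa [abs_of_pos hβ]
  have hatom (u : ℂ) : robinDefect β ε t (fun w => edgeAmp β p u * expAtom u w) =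
      edgeLower β p ε t (u - I * β) - edgeUpper β p t (u + I * β) := by
    rw [robinDefect_const_mul habs ht fun w _ => (hasDerivAt_expAtom u w).differentiableAt,
      edgeAmp_mul_robinDefect]
  induction n with
  | zero =>
    convert! hatom (φ * I) using 2
    · ext w
      simp [expLadder]
    · push_cast; ring_nf
    · push_cast; ring_nf
  | succ n ih =>
    have hstep : edgeUpper β p t ((φ - (2 * n + 1) * β : ℝ) * I) =
        edgeLower β p ε t ((φ - (2 * n + 1) * β : ℝ) * I) := by
      refine edgeUpper_eq_edgeLower hβ hε ?_
      have : 0 ≤ n * β := by positivity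
      push_cast at hn
      rw [im_ofReal_mul, I_im, mul_one, abs_lt]
      constructor <;> linarith
    have hsplit : expLadder β p φ (n + 1 + 1) = fun w => expLadder β p φ (n + 1) w +
      edgeAmp β p ((φ - 2 * (n + 1 : ℕ) * β : ℝ) * I) *
        expAtom ((φ - 2 * (n + 1 : ℕ) * β : ℝ) * I) w := funext fun w => expLadder_succ w
    rw [hsplit, robinDefect_add habs ht (fun w _ => differentiable_expLadder _ _ _ _ w)
      (fun w _ => (hasDerivAt_expAtom _ w).differentiableAt.const_mul _), hatom,
      ih (by push_cast at hn; linarith), ← hstep]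
    push_cast
    ring_nf

theorem edgeUpper_pi_div_two (β p t : ℝ) : edgeUpper β p t ((π / 2 : ℝ) * I) = 0 := by
  rw [edgeUpper, ofReal_div, ofReal_ofNat, exp_pi_div_two_mul_I, I_mul_I, add_neg_cancel, zero_mul,
    zero_mul]

theorem edgeLower_neg_pi_div_two (β p t : ℝ) (ε : ℂ) :
    edgeLower β p ε t ((-(π / 2) : ℝ) * I) = 0 := by
  have hexp : exp ((-(π / 2) : ℝ) * I) = I⁻¹ := by
    rw [ofReal_neg, neg_mul, exp_neg, ofReal_div, ofReal_ofNat, exp_pi_div_two_mul_I]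
  rw [edgeLower, hexp, mul_inv_cancel₀ I_ne_zero, sub_self, mul_zero, zero_mul, zero_mul]

/-- The phase shift of the plane waves of an edge of half-angle `β`. -/
noncomputable def edgePhase (β : ℝ) : ℝ := π / 4 * (π / (2 * β) - 1)

/-- The angle `φ` for which `w ↦ e^{-w e^{iφ}}` is a plane wave along the side `arg w = β`; its
opposite gives the plane wave along the other side. -/
noncomputable def edgeAngle (β : ℝ) : ℝ := π / 2 - β

/-- The plane waves along the two sides of the sector `|arg w| < β`, with the amplitudes
`e^{∓iεσ}`, where `σ` is the phase shift of the edge. -/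
noncomputable def edgeWaves (β ε : ℝ) (w : ℂ) : ℂ :=
  exp (-(I * ε * edgePhase β)) * expAtom (edgeAngle β * I) w +
    exp (I * ε * edgePhase β) * expAtom ((-edgeAngle β : ℝ) * I) w

/-- There is a decaying correction of the two plane waves which makes them satisfy the Robin
condition on both sides, up to the sign `ε` on the side `arg w = -β`. -/
def HasEdgeProfile (β ε : ℝ) : Prop :=
  ∃ g, IsDecayingProfile β (π / (2 * β)) g ∧
    ∀ t : ℝ, 0 < t → robinDefect β ε t (fun w => edgeWaves β ε w + g w) = 0

theorem hasEdgeProfile_of_const_mul {ε : ℝ} (hβ : 0 < β) (hβ' : β < π / 2) {κ : ℂ} (hκ : κ ≠ 0)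
    {g : ℂ → ℂ} (hg : IsDecayingProfile β (π / (2 * β)) g)
    (hdefect : ∀ t : ℝ, 0 < t → robinDefect β ε t (fun w => κ * edgeWaves β ε w + g w) = 0) :
    HasEdgeProfile β ε := by
  refine ⟨fun w => κ⁻¹ * g w, hg.const_mul hβ' _, fun t ht => ?_⟩
  have hatom (u w : ℂ) : DifferentiableAt ℂ (expAtom u) w :=
    (hasDerivAt_expAtom u w).differentiableAt
  have hdiff (w : ℂ) (hw : 0 < w.re) :
      DifferentiableAt ℂ (fun w => κ * edgeWaves β ε w + g w) w :=
    (((hatom _ w).const_mul _).add ((hatom _ w).const_mul _)).const_mul κ |>.add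
      (hg.differentiableAt w hw)
  have hscale : (fun w => edgeWaves β ε w + κ⁻¹ * g w) =
      fun w => κ⁻¹ * (κ * edgeWaves β ε w + g w) := by
    ext w
    field_simp
  rw [hscale, robinDefect_const_mul (by rwa [abs_of_pos hβ]) ht hdiff, hdefect t ht, mul_zero]

theorem edgeAmp_edgeAngle (hβ : β ≠ 0) (ε : ℝ) :
    edgeAmp β (1 - ε / 4) (edgeAngle β * I) =
      exp (malyuzhinetsLog β (edgeAngle β * I)) * stripExp β (edgeAngle β * I) *
        exp (-(I * ε * edgePhase β)) := by
  have hβc : (β : ℂ) ≠ 0 := ofReal_ne_zero.2 hβ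
  rw [edgeAmp, stripExp, ← exp_add, ← exp_add, add_assoc, edgeAngle, edgePhase]
  congr 2
  push_cast
  field_simp
  ring

theorem edgeAmp_neg_edgeAngle (hβ : β ≠ 0) (ε : ℝ) :
    edgeAmp β (1 - ε / 4) ((-edgeAngle β : ℝ) * I) =
      exp (malyuzhinetsLog β (edgeAngle β * I)) * stripExp β ((-edgeAngle β : ℝ) * I) *
        exp (I * ε * edgePhase β) := by
  have hβc : (β : ℂ) ≠ 0 := ofReal_ne_zero.2 hβ
  have hneg : ((-edgeAngle β : ℝ) : ℂ) * I = -(edgeAngle β * I) := by push_cast; ring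
  rw [hneg, edgeAmp, malyuzhinetsLog_neg, stripExp, ← exp_add, ← exp_add, add_assoc, edgeAngle,
    edgePhase]
  congr 2
  push_cast
  field_simp
  ring

/-- The ladder descends exactly from one plane wave to the other, and no Laplace integral is
needed. -/
theorem hasEdgeProfile_of_pi_div_two_eq {ε : ℝ} (hβ : 0 < β) (hβ' : β < π / 2)
    (hε : (ε : ℂ) * I * exp (2 * π * (1 - ε / 4 : ℝ) * I) = 1) {m : ℕ}
    (hm : π / 2 = (2 * m + 3) * β) : HasEdgeProfile β ε := by
  have : 0 ≤ m * β := by positivity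
  have hstrip : stripExp β (edgeAngle β * I) = 1 := by
    have hβc : (β : ℂ) ≠ 0 := ofReal_ne_zero.2 hβ.ne'
    rw [stripExp, edgeAngle, hm, exp_eq_one_iff]
    refine ⟨m + 1, ?_⟩
    push_cast
    field_simp
    ring
  have hstrip' : stripExp β ((-edgeAngle β : ℝ) * I) = 1 := by
    rw [ofReal_neg, neg_mul, stripExp_neg, hstrip, inv_one]
  have hlast : edgeAngle β - 2 * (2 * m + 1 + 1 : ℕ) * β = -edgeAngle β := by
    rw [edgeAngle, hm]; push_cast; ring
  refine hasEdgeProfile_of_const_mul (κ := exp (malyuzhinetsLog β (edgeAngle β * I))) hβ hβ'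
    (exp_ne_zero _) (isDecayingProfile_expLadder (p := 1 - ε / 4) (φ := edgeAngle β - 2 * β)
      (n := 2 * m + 1) hβ hβ' (by rw [edgeAngle]; linarith)
      (by rw [edgeAngle]; push_cast; linarith) _) fun t ht => ?_
  have hladder : (fun w => exp (malyuzhinetsLog β (edgeAngle β * I)) * edgeWaves β ε w +
      expLadder β (1 - ε / 4) (edgeAngle β - 2 * β) (2 * m + 1) w) =
      expLadder β (1 - ε / 4) (edgeAngle β) (2 * m + 1 + 1 + 1) := by
    ext w
    rw [expLadder_succ (n := 2 * m + 1 + 1), hlast, expLadder_succ' (n := 2 * m + 1),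
      edgeAmp_edgeAngle hβ.ne', edgeAmp_neg_edgeAngle hβ.ne', hstrip, hstrip', edgeWaves]
    ring
  have hbot : edgeAngle β - (2 * (2 * m + 1 + 1 : ℕ) + 1) * β = -(π / 2) := by
    rw [edgeAngle, hm]; push_cast; ring
  rw [hladder, robinDefect_expLadder_succ hβ hβ' ht hε (by rw [edgeAngle]; linarith)
    (by rw [edgeAngle]; push_cast; linarith), hbot, edgeLower_neg_pi_div_two,
    edgeAngle, sub_add_cancel, edgeUpper_pi_div_two, sub_zero]

/-- The Laplace integral and the two ladders that join its poles to the plane waves. The weights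
are such that the Robin defects of the ladders cancel the residues of the integral. -/
noncomputable def edgeIntegralSum (β p s φ φ' : ℝ) (n n' : ℕ) (w : ℂ) : ℂ :=
  laplaceLog (edgeDensity β p s) w +
    (2 * I * β / stripExp β (s * I) * expLadder β p φ n w +
      2 * I * β / stripExp β ((-s : ℝ) * I) * expLadder β p φ' n' w)

theorem isDecayingProfile_laplaceLog_edgeDensity {s : ℝ} (hβ : 0 < β) (hβ' : β < π / 2)
    (hp : 3 / 4 ≤ p) (hp' : p ≤ 5 / 4) (hs : |s| < β) :
    IsDecayingProfile β (π / (2 * β)) (laplaceLog (edgeDensity β p s)) := by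
  obtain ⟨C, hC⟩ := exists_norm_edgeDensity_le_exp_mul hβ hs hp hp'
  exact isDecayingProfile_laplaceLog hβ.le hβ' (by positivity)
    (integrable_edgeDensity hβ hs hp hp') hC

theorem robinDefect_edgeIntegralSum (hβ : 0 < β) (hβ' : β < π / 2) (ht : 0 < t) (hp : 3 / 4 ≤ p)
    (hp' : p ≤ 5 / 4) (hε : ε * I * exp (2 * π * p * I) = 1) {m : ℕ} {s : ℝ} (hs : |s| < β)
    (hm : π / 2 = s + 2 * (m + 1) * β) :
    robinDefect β ε t (edgeIntegralSum β p s (edgeAngle β) (-s - β) (m + 1) (m + 1)) = 0 := by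
  have habs : |β| < π / 2 := by rwa [abs_of_pos hβ]
  have hmβ : 0 ≤ m * β := by positivity
  obtain ⟨hs_gt, _⟩ := abs_lt.1 hs
  have hupper : robinDefect β ε t (expLadder β p (edgeAngle β) (m + 1)) =
      edgeUpper β p t (s * I) := by
    have hbot : edgeAngle β - (2 * m + 1) * β = s := by rw [edgeAngle, hm]; ring
    rw [robinDefect_expLadder_succ hβ hβ' ht hε (by rw [edgeAngle]; linarith)
      (by rw [edgeAngle]; linarith), hbot, edgeAngle, sub_add_cancel, edgeUpper_pi_div_two,
      sub_zero, edgeUpper_eq_edgeLower hβ hε]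
    rw [im_ofReal_mul, I_im, mul_one]
    exact hs.trans hβ'
  have hlower : robinDefect β ε t (expLadder β p (-s - β) (m + 1)) =
      -edgeUpper β p t ((-s : ℝ) * I) := by
    have hbot : -s - β - (2 * m + 1) * β = -(π / 2) := by rw [hm]; ring
    rw [robinDefect_expLadder_succ hβ hβ' ht hε (by linarith) (by linarith), hbot,
      edgeLower_neg_pi_div_two, sub_add_cancel, zero_sub]
  have hdiff (c : ℂ) (φ : ℝ) (w : ℂ) (_ : 0 < w.re) :
      DifferentiableAt ℂ (fun w => c * expLadder β p φ (m + 1) w) w :=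
    (differentiable_expLadder _ _ _ _ w).const_mul c
  have hconst (c : ℂ) (φ : ℝ) : robinDefect β ε t (fun w => c * expLadder β p φ (m + 1) w) =
      c * robinDefect β ε t (expLadder β p φ (m + 1)) :=
    robinDefect_const_mul habs ht (fun w _ => differentiable_expLadder _ _ _ _ w) c
  unfold edgeIntegralSum
  rw [robinDefect_add habs ht
      (isDecayingProfile_laplaceLog_edgeDensity hβ hβ' hp hp' hs).differentiableAt
      (fun w hw => (hdiff _ _ w hw).fun_add (hdiff _ _ w hw)),
    robinDefect_add habs ht (hdiff _ _) (hdiff _ _), hconst, hconst, hupper, hlower,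
    robinDefect_laplaceLog_edgeDensity hβ hβ' ht hp hp' hε hs]
  ring

theorem edgeIntegralSum_succ {ε s : ℝ} (hβ : 0 < β) {m : ℕ}
    (hm : π / 2 = s + 2 * (m + 1) * β) (w : ℂ) :
    edgeIntegralSum β (1 - ε / 4) s (edgeAngle β) (-s - β) (m + 1) (m + 1) w =
      -(2 * I * β) * exp (malyuzhinetsLog β (edgeAngle β * I)) * edgeWaves β ε w +
        edgeIntegralSum β (1 - ε / 4) s (edgeAngle β - 2 * β) (-s - β) m m w := by
  have hstrip : stripExp β (edgeAngle β * I) = -stripExp β (s * I) := by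
    rw [← stripExp_add_odd_mul hβ.ne' _ m, edgeAngle, hm]
    push_cast
    ring_nf
  have hstrip' : stripExp β ((-edgeAngle β : ℝ) * I) = -stripExp β ((-s : ℝ) * I) := by
    rw [ofReal_neg, neg_mul, stripExp_neg, hstrip, ofReal_neg, neg_mul, stripExp_neg, inv_neg]
  have hlast : -s - β - 2 * m * β = -edgeAngle β := by rw [edgeAngle, hm]; ring
  have hE : stripExp β (s * I) ≠ 0 := exp_ne_zero _
  have hE' : stripExp β ((-s : ℝ) * I) ≠ 0 := exp_ne_zero _
  rw [edgeIntegralSum, expLadder_succ', expLadder_succ, hlast, edgeAmp_edgeAngle hβ.ne',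
    edgeAmp_neg_edgeAngle hβ.ne', hstrip, hstrip', edgeWaves, edgeIntegralSum]
  generalize stripExp β (s * I) = E at hE ⊢
  generalize stripExp β ((-s : ℝ) * I) = E' at hE' ⊢
  field_simp
  ring

theorem hasEdgeProfile_of_abs_lt {ε : ℝ} (hβ : 0 < β) (hβ' : β < π / 2) (hε_abs : |ε| ≤ 1)
    (hε : (ε : ℂ) * I * exp (2 * π * (1 - ε / 4 : ℝ) * I) = 1) {m : ℕ} {s : ℝ} (hs : |s| < β)
    (hm : π / 2 = s + 2 * (m + 1) * β) : HasEdgeProfile β ε := by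
  obtain ⟨hε_ge, hε_le⟩ := abs_le.1 hε_abs
  obtain ⟨hs_gt, _⟩ := abs_lt.1 hs
  have hp : 3 / 4 ≤ 1 - ε / 4 := by linarith
  have hp' : 1 - ε / 4 ≤ 5 / 4 := by linarith
  have hβc : (β : ℂ) ≠ 0 := ofReal_ne_zero.2 hβ.ne'
  have hκ : -(2 * I * β) * exp (malyuzhinetsLog β (edgeAngle β * I)) ≠ 0 := by simp [hβc]
  have hdecay : IsDecayingProfile β (π / (2 * β))
      (edgeIntegralSum β (1 - ε / 4) s (edgeAngle β - 2 * β) (-s - β) m m) :=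
    (isDecayingProfile_laplaceLog_edgeDensity hβ hβ' hp hp' hs).add hβ'
      (((isDecayingProfile_expLadder hβ hβ' (by rw [edgeAngle]; linarith)
        (by rw [edgeAngle]; linarith) _).const_mul hβ' _).add hβ'
      ((isDecayingProfile_expLadder hβ hβ' (by linarith) (by linarith) _).const_mul hβ' _))
  refine hasEdgeProfile_of_const_mul hβ hβ' hκ hdecay fun t ht => ?_
  simp only [← edgeIntegralSum_succ hβ hm]
  exact robinDefect_edgeIntegralSum hβ hβ' ht hp hp' hε hs hm

theorem ofReal_mul_I_mul_exp_eq_one {ε : ℝ} (hε : ε = 1 ∨ ε = -1) :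
    (ε : ℂ) * I * exp (2 * π * (1 - ε / 4 : ℝ) * I) = 1 := by
  have hexp : (2 : ℂ) * π * (1 - ε / 4 : ℝ) * I = 2 * π * I + -(ε * (π / 2 * I)) := by
    push_cast
    ring
  rw [hexp, exp_add, exp_two_pi_mul_I]
  rcases hε with rfl | rfl <;> simp [exp_neg, exp_pi_div_two_mul_I]

theorem exists_pi_div_two_eq_or_abs_lt (hβ : 0 < β) (hβ' : β < π / 2) :
    (∃ m : ℕ, π / 2 = (2 * m + 3) * β) ∨
      ∃ (m : ℕ) (s : ℝ), |s| < β ∧ π / 2 = s + 2 * (m + 1) * β := by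
  set y : ℝ := π / (4 * β) + 1 / 2 with hy
  have hπ : π / 2 = (2 * y - 1) * β := by rw [hy]; field_simp; ring
  have hy1 : 1 < y := by nlinarith
  obtain ⟨m, hm⟩ : ∃ m : ℕ, ⌊y⌋₊ = m + 1 :=
    Nat.exists_eq_succ_of_ne_zero (Nat.floor_pos.2 hy1.le).ne'
  have hle : (m : ℝ) + 1 ≤ y := by
    exact_mod_cast hm ▸ Nat.floor_le (by linarith : 0 ≤ y)
  have hlt : y < (m : ℝ) + 1 + 1 := by
    exact_mod_cast hm ▸ Nat.lt_floor_add_one y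
  rcases hle.eq_or_lt with h | h
  · obtain _ | k := m
    · norm_num at h
      linarith
    · exact .inl ⟨k, by rw [hπ, ← h]; push_cast; ring⟩
  · refine .inr ⟨m, (2 * y - 1) * β - 2 * (m + 1) * β, ?_, by rw [hπ]; ring⟩
    rw [abs_lt]
    constructor <;> nlinarith

theorem hasEdgeProfile {ε : ℝ} (hβ : 0 < β) (hβ' : β < π / 2) (hε : ε = 1 ∨ ε = -1) :
    HasEdgeProfile β ε := by
  have hsign := ofReal_mul_I_mul_exp_eq_one hε
  obtain ⟨m, hm⟩ | ⟨m, s, hs, hm⟩ := exists_pi_div_two_eq_or_abs_lt hβ hβ'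
  · exact hasEdgeProfile_of_pi_div_two_eq hβ hβ' hsign hm
  · exact hasEdgeProfile_of_abs_lt hβ hβ' (by rcases hε with rfl | rfl <;> simp) hsign hs hm

end EdgeProfile

section SectorGeometry

open Complex Set
open scoped Real

variable {α β ρ θ : ℝ} {z : ℂ}

theorem mul_exp_mul_I_eq_polar (φ : ℝ) (z : ℂ) :
    z * exp (φ * I) = ‖z‖ * exp ((z.arg + φ : ℝ) * I) := by
  conv_lhs => rw [← norm_mul_exp_arg_mul_I z]
  rw [mul_assoc, ← exp_add, ofReal_add, add_mul]

theorem sector_eq_inter (hα : 0 < α) (hα' : α < π) :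
    sector α = {z | z.im < 0} ∩ {z | 0 < (z * exp (α * I)).im} := by
  ext z
  have him : (z * exp (α * I)).im = ‖z‖ * Real.sin (z.arg + α) := by
    rw [mul_exp_mul_I_eq_polar, im_ofReal_mul, exp_ofReal_mul_I_im]
  simp only [sector, mem_inter_iff, mem_ofPred_eq, him, arg_neg_iff]
  rw [and_comm]
  refine and_congr_right fun hz => ?_
  have hz0 : 0 < ‖z‖ := norm_pos_iff.2 fun h => by simp [h] at hz
  have harg := arg_neg_iff.2 hz
  rw [mul_pos_iff_of_pos_left hz0]
  constructor
  · intro h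
    exact Real.sin_pos_of_pos_of_lt_pi (by linarith) (by linarith)
  · contrapose!
    intro h
    exact Real.sin_nonpos_of_nonpos_of_neg_pi_le (by linarith) (by linarith [neg_pi_lt_arg z])

theorem isOpen_sector (hα : 0 < α) (hα' : α < π) : IsOpen (sector α) := by
  rw [sector_eq_inter hα hα']
  exact (isOpen_lt continuous_im continuous_const).inter
    (isOpen_lt continuous_const (by fun_prop))

theorem convex_sector (hα : 0 < α) (hα' : α < π) : Convex ℝ (sector α) := by
  rw [sector_eq_inter hα hα']
  exact (convex_halfSpace_im_lt 0).inter
    ((convex_halfSpace_im_gt 0).linear_preimage (LinearMap.mulRight ℝ (exp (α * I))))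

theorem polar_mem_sector (hα : α < π) (hρ : 0 < ρ) (hθ : -α < θ) (hθ' : θ < 0) :
    (ρ : ℂ) * exp (θ * I) ∈ sector α := by
  have harg : ((ρ : ℂ) * exp (θ * I)).arg = θ := by
    rw [arg_real_mul _ hρ, arg_exp_mul_I, toIocMod_eq_self]
    constructor <;> linarith [Real.pi_pos]
  rw [sector, mem_ofPred_eq, harg]
  exact ⟨hθ, hθ'⟩

theorem polar_mem_closure_sector (hα : 0 < α) (hα' : α < π) (hρ : 0 < ρ) (hθ : -α ≤ θ)
    (hθ' : θ ≤ 0) : (ρ : ℂ) * exp (θ * I) ∈ closure (sector α) := by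
  have hcont : Continuous fun θ : ℝ => (ρ : ℂ) * exp (θ * I) := by fun_prop
  have hmem : θ ∈ closure (Ioo (-α) 0) := by
    rw [closure_Ioo (by linarith)]
    exact ⟨hθ, hθ'⟩
  exact map_mem_closure (f := fun θ : ℝ => (ρ : ℂ) * exp (θ * I)) hcont hmem fun φ hφ =>
    polar_mem_sector hα' hρ hφ.1 hφ.2

theorem uniqueDiffOn_closure_sector (hα : 0 < α) (hα' : α < π) :
    UniqueDiffOn ℝ (closure (sector α)) := by
  refine uniqueDiffOn_convex (convex_sector hα hα').closure
    (Nonempty.mono (interior_mono subset_closure) ?_)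
  rw [(isOpen_sector hα hα').interior_eq]
  exact ⟨_, polar_mem_sector (θ := -(α / 2)) hα' one_pos (by linarith) (by linarith)⟩

theorem ne_zero_of_mem_sector (hz : z ∈ sector α) : z ≠ 0 := by
  rintro rfl
  simpa using hz.2

theorem exists_polar_of_mem_sector (hz : z ∈ sector (2 * β)) :
    ∃ θ : ℝ, |θ| ≤ β ∧ z * exp (β * I) = ‖z‖ * exp (θ * I) ∧
      conj (z * exp (β * I)) = ‖z‖ * exp ((-θ : ℝ) * I) := by
  have hpolar := mul_exp_mul_I_eq_polar β z
  refine ⟨z.arg + β, ?_, hpolar, ?_⟩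
  · rw [abs_le]
    constructor <;> linarith [hz.1, hz.2]
  · rw [hpolar, map_mul, conj_ofReal, ← exp_conj, map_mul, conj_ofReal, conj_I, ofReal_neg,
      neg_mul, mul_neg]

theorem norm_mul_cos_le_re_of_mem_closure_sector (hβ : β < π / 2)
    (hz : z ∈ closure (sector (2 * β))) : ‖z‖ * Real.cos β ≤ (z * exp (β * I)).re := by
  have hclosed : IsClosed {z : ℂ | ‖z‖ * Real.cos β ≤ (z * exp (β * I)).re} :=
    isClosed_le (by fun_prop) (by fun_prop)
  refine closure_minimal (fun w hw => ?_) hclosed hz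
  obtain ⟨θ, hθ, hpolar, -⟩ := exists_polar_of_mem_sector hw
  rw [mem_ofPred_eq, hpolar, re_polar]
  gcongr
  exact cos_le_cos_of_abs_le hβ hθ

end SectorGeometry

section FoldedWave

open Complex Filter Topology Set
open scoped Real

/-- The harmonic function built from two holomorphic functions of the rotated variable
`w = z e^{iβ}`, for which the bisector of the sector `-2β < arg z < 0` is the positive real axis. -/
noncomputable def foldedWave (β : ℝ) (f₁ f₂ : ℂ → ℂ) (z : ℂ) : ℂ :=
  f₁ (z * exp (β * I)) + f₂ (conj (z * exp (β * I)))

variable {β μ K t : ℝ} {f f' f₁ f₂ : ℂ → ℂ} {z : ℂ}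

theorem exists_hasFDerivAt_foldedWave (h₁ : DifferentiableAt ℂ f₁ (z * exp (β * I)))
    (h₂ : DifferentiableAt ℂ f₂ (conj (z * exp (β * I)))) :
    ∃ L : ℂ →L[ℝ] ℂ, HasFDerivAt (foldedWave β f₁ f₂) L z ∧ ∀ v, L v =
      v * exp (β * I) * deriv f₁ (z * exp (β * I)) +
        conj (v * exp (β * I)) * deriv f₂ (conj (z * exp (β * I))) := by
  have hrot : HasFDerivAt (𝕜 := ℝ) (fun z : ℂ => z * exp (β * I)) _ z :=
    ((hasDerivAt_mul_const (exp (β * I))).hasFDerivAt (x := z)).restrictScalars ℝ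
  have hrot_conj := conjCLE.hasFDerivAt.comp z hrot
  have hf₁ := (h₁.hasDerivAt.hasFDerivAt.restrictScalars ℝ).comp z hrot
  have hf₂ := HasFDerivAt.comp (f := conjCLE ∘ fun z : ℂ => z * exp (β * I)) z
    (h₂.hasDerivAt.hasFDerivAt.restrictScalars ℝ) hrot_conj
  exact ⟨_, hf₁.add hf₂, fun v => by simp⟩

theorem contDiffAt_foldedWave (h₁ : AnalyticAt ℂ f₁ (z * exp (β * I)))
    (h₂ : AnalyticAt ℂ f₂ (conj (z * exp (β * I)))) : ContDiffAt ℝ 1 (foldedWave β f₁ f₂) z := by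
  have hrot : ContDiffAt ℝ 1 (fun z : ℂ => z * exp (β * I)) z := by fun_prop
  have hrot_conj : ContDiffAt ℝ 1 (fun z : ℂ => conj (z * exp (β * I))) z :=
    conjCLE.contDiff.contDiffAt.comp z hrot
  exact (ContDiffAt.comp z (h₁.contDiffAt.restrict_scalars ℝ) hrot).add
    (ContDiffAt.comp (f := fun z : ℂ => conj (z * exp (β * I))) z
      (h₂.contDiffAt.restrict_scalars ℝ) hrot_conj)

theorem harmonicAt_foldedWave (h₁ : AnalyticAt ℂ f₁ (z * exp (β * I)))
    (h₂ : AnalyticAt ℂ f₂ (conj (z * exp (β * I)))) :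
    InnerProductSpace.HarmonicAt (foldedWave β f₁ f₂) z := by
  have hrot : AnalyticAt ℂ (fun z : ℂ => z * exp (β * I)) z := by fun_prop
  have hf₁ : AnalyticAt ℂ (fun z : ℂ => f₁ (z * exp (β * I))) z :=
    AnalyticAt.comp (f := fun z : ℂ => z * exp (β * I)) h₁ hrot
  have hf₂_conj : AnalyticAt ℂ (conj ∘ f₂ ∘ conj) (z * exp (β * I)) := by
    rw [analyticAt_iff_eventually_differentiableAt] at h₂ ⊢
    filter_upwards [(continuous_conj.tendsto (z * exp (β * I))).eventually h₂] with w hw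
    simpa only [conj_conj] using hw.conj_conj
  have hf₂ : AnalyticAt ℂ (fun z : ℂ => conj (f₂ (conj (z * exp (β * I))))) z :=
    AnalyticAt.comp (f := fun z : ℂ => z * exp (β * I)) hf₂_conj hrot
  convert! hf₁.harmonicAt.add hf₂.harmonicAt_conj using 1
  ext w
  simp [foldedWave]

theorem analyticAt_of_mem_closure_sector (hβ : |β| < π / 2)
    (hd₁ : ∀ w : ℂ, 0 < w.re → DifferentiableAt ℂ f₁ w)
    (hd₂ : ∀ w : ℂ, 0 < w.re → DifferentiableAt ℂ f₂ w) (hz : z ∈ closure (sector (2 * β)))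
    (hz0 : z ≠ 0) :
    AnalyticAt ℂ f₁ (z * exp (β * I)) ∧ AnalyticAt ℂ f₂ (conj (z * exp (β * I))) := by
  have hre : 0 < (z * exp (β * I)).re :=
    (mul_pos (norm_pos_iff.2 hz0) (Real.cos_pos_of_mem_Ioo (abs_lt.1 hβ))).trans_le
      (norm_mul_cos_le_re_of_mem_closure_sector (abs_lt.1 hβ).2 hz)
  have hanalytic {f : ℂ → ℂ} (hd : ∀ w : ℂ, 0 < w.re → DifferentiableAt ℂ f w) {w : ℂ}
      (hw : 0 < w.re) : AnalyticAt ℂ f w :=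
    DifferentiableOn.analyticAt (s := {w : ℂ | 0 < w.re})
      (fun v hv => (hd v hv).differentiableWithinAt)
      ((isOpen_lt continuous_const continuous_re).mem_nhds hw)
  exact ⟨hanalytic hd₁ hre, hanalytic hd₂ (by rwa [conj_re])⟩

theorem continuousOn_foldedWave (hβ : |β| < π / 2) (hc₁ : ContinuousOn f₁ {w | 0 ≤ w.re})
    (hc₂ : ContinuousOn f₂ {w | 0 ≤ w.re}) :
    ContinuousOn (foldedWave β f₁ f₂) (closure (sector (2 * β))) := by
  have hre {z : ℂ} (hz : z ∈ closure (sector (2 * β))) : 0 ≤ (z * exp (β * I)).re :=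
    (mul_nonneg (norm_nonneg z) (Real.cos_pos_of_mem_Ioo (abs_lt.1 hβ)).le).trans
      (norm_mul_cos_le_re_of_mem_closure_sector (abs_lt.1 hβ).2 hz)
  refine (hc₁.comp (by fun_prop) fun z hz => hre hz).add
    (hc₂.comp (continuous_conj.comp (by fun_prop)).continuousOn fun z hz => ?_)
  rw [mem_ofPred_eq, conj_re]
  exact hre hz

theorem fderivWithin_foldedWave (hβ : 0 < β) (hβ' : β < π / 2)
    (hd₁ : ∀ w : ℂ, 0 < w.re → DifferentiableAt ℂ f₁ w)
    (hd₂ : ∀ w : ℂ, 0 < w.re → DifferentiableAt ℂ f₂ w) (hz : z ∈ closure (sector (2 * β)))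
    (hz0 : z ≠ 0) (v : ℂ) :
    fderivWithin ℝ (foldedWave β f₁ f₂) (closure (sector (2 * β))) z v =
      v * exp (β * I) * deriv f₁ (z * exp (β * I)) +
        conj (v * exp (β * I)) * deriv f₂ (conj (z * exp (β * I))) := by
  obtain ⟨h₁, h₂⟩ := analyticAt_of_mem_closure_sector (by rwa [abs_of_pos hβ]) hd₁ hd₂ hz hz0
  obtain ⟨L, hL, hLv⟩ := exists_hasFDerivAt_foldedWave h₁.differentiableAt h₂.differentiableAt
  rw [hL.hasFDerivWithinAt.fderivWithin
    (uniqueDiffOn_closure_sector (by linarith) (by linarith) z hz), hLv]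

theorem conj_exp_ofReal_mul_I (x : ℝ) : conj (exp (x * I)) = exp (-(x * I)) := by
  rw [← exp_conj, map_mul, conj_ofReal, conj_I, mul_neg]

theorem fderivWithin_foldedWave_sideOut (hβ : 0 < β) (hβ' : β < π / 2) (ht : 0 < t)
    (hd₁ : ∀ w : ℂ, 0 < w.re → DifferentiableAt ℂ f₁ w)
    (hd₂ : ∀ w : ℂ, 0 < w.re → DifferentiableAt ℂ f₂ w) :
    fderivWithin ℝ (foldedWave β f₁ f₂) (closure (sector (2 * β))) t I =
      I * exp (β * I) * deriv f₁ (t * exp (β * I)) -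
        I * exp (-(β * I)) * deriv f₂ (t * exp (-(β * I))) := by
  have hmem : (t : ℂ) ∈ closure (sector (2 * β)) := by
    simpa using polar_mem_closure_sector (α := 2 * β) (θ := 0) (by linarith) (by linarith) ht
      (by linarith) le_rfl
  rw [fderivWithin_foldedWave hβ hβ' hd₁ hd₂ hmem (ofReal_ne_zero.2 ht.ne'), map_mul, map_mul,
    conj_ofReal, conj_I, conj_exp_ofReal_mul_I]
  ring

theorem exp_neg_two_mul_mul_I_mul_exp (β : ℝ) :
    exp (-((2 * β : ℝ) * I)) * exp (β * I) = exp (-(β * I)) := by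
  rw [← exp_add]
  push_cast
  ring_nf

theorem fderivWithin_foldedWave_sideIn (hβ : 0 < β) (hβ' : β < π / 2) (ht : 0 < t)
    (hd₁ : ∀ w : ℂ, 0 < w.re → DifferentiableAt ℂ f₁ w)
    (hd₂ : ∀ w : ℂ, 0 < w.re → DifferentiableAt ℂ f₂ w) :
    fderivWithin ℝ (foldedWave β f₁ f₂) (closure (sector (2 * β)))
        (t * exp (-((2 * β : ℝ) * I))) (-I * exp (-((2 * β : ℝ) * I))) =
      I * exp (β * I) * deriv f₂ (t * exp (β * I)) -
        I * exp (-(β * I)) * deriv f₁ (t * exp (-(β * I))) := by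
  have hmem : (t : ℂ) * exp (-((2 * β : ℝ) * I)) ∈ closure (sector (2 * β)) := by
    simpa using polar_mem_closure_sector (α := 2 * β) (by linarith) (by linarith) ht le_rfl
      (by linarith)
  have hne : (t : ℂ) * exp (-((2 * β : ℝ) * I)) ≠ 0 :=
    mul_ne_zero (ofReal_ne_zero.2 ht.ne') (exp_ne_zero _)
  rw [fderivWithin_foldedWave hβ hβ' hd₁ hd₂ hmem hne, mul_assoc (t : ℂ), mul_assoc (-I),
    exp_neg_two_mul_mul_I_mul_exp, map_mul, map_mul, map_neg, conj_ofReal, conj_I,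
    ← conj_exp_ofReal_mul_I, conj_conj]
  ring

theorem isRobinSolution_foldedWave (hβ : 0 < β) (hβ' : β < π / 2)
    (hd : ∀ w : ℂ, 0 < w.re → DifferentiableAt ℂ f w)
    (hd' : ∀ w : ℂ, 0 < w.re → DifferentiableAt ℂ f' w)
    (hc : ContinuousOn f {w | 0 ≤ w.re}) (hc' : ContinuousOn f' {w | 0 ≤ w.re})
    (hdefect : ∀ t : ℝ, 0 < t → robinDefect β 1 t f = 0)
    (hdefect' : ∀ t : ℝ, 0 < t → robinDefect β (-1) t f' = 0) :
    IsRobinSolution (2 * β) (foldedWave β (fun w => f w + f' w) (fun w => f w - f' w)) := by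
  have habs : |β| < π / 2 := by rwa [abs_of_pos hβ]
  have hd₁ (w : ℂ) (hw : 0 < w.re) := (hd w hw).fun_add (hd' w hw)
  have hd₂ (w : ℂ) (hw : 0 < w.re) := (hd w hw).fun_sub (hd' w hw)
  have hanalytic {z : ℂ} (hz : z ∈ closure (sector (2 * β))) (hz0 : z ≠ 0) :=
    analyticAt_of_mem_closure_sector habs hd₁ hd₂ hz hz0
  have hderiv {w : ℂ} (hw : 0 < w.re) := (hd w hw).hasDerivAt.fun_add (hd' w hw).hasDerivAt
  have hderiv' {w : ℂ} (hw : 0 < w.re) := (hd w hw).hasDerivAt.fun_sub (hd' w hw).hasDerivAt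
  refine ⟨fun z hz => ?_, continuousOn_foldedWave habs (hc.add hc') (hc.sub hc'), ?_, ?_, ?_⟩
  · obtain ⟨h₁, h₂⟩ := hanalytic (subset_closure hz) (ne_zero_of_mem_sector hz)
    exact harmonicAt_foldedWave h₁ h₂
  · rintro z ⟨hz, hz0⟩
    obtain ⟨h₁, h₂⟩ := hanalytic hz hz0
    exact (contDiffAt_foldedWave h₁ h₂).contDiffWithinAt
  · rintro z ⟨t, ht, rfl⟩
    obtain ⟨hre, hre'⟩ := re_ray_pos habs ht
    rw [fderivWithin_foldedWave_sideOut hβ hβ' ht hd₁ hd₂, (hderiv hre).deriv, (hderiv' hre').deriv,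
      foldedWave, map_mul, conj_ofReal, conj_exp_ofReal_mul_I]
    have heven := hdefect t ht
    have hodd := hdefect' t ht
    simp only [robinDefect] at heven hodd
    linear_combination heven + hodd
  · rintro z ⟨t, ht, rfl⟩
    obtain ⟨hre, hre'⟩ := re_ray_pos habs ht
    rw [fderivWithin_foldedWave_sideIn hβ hβ' ht hd₁ hd₂, (hderiv' hre).deriv, (hderiv hre').deriv,
      foldedWave, mul_assoc (t : ℂ), exp_neg_two_mul_mul_I_mul_exp, map_mul, conj_ofReal,
      ← conj_exp_ofReal_mul_I, conj_conj]
    have heven := hdefect t ht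
    have hodd := hdefect' t ht
    simp only [robinDefect, ← conj_exp_ofReal_mul_I] at heven hodd
    linear_combination heven - hodd

theorem gradNorm_foldedWave_le (h₁ : DifferentiableAt ℂ f₁ (z * exp (β * I)))
    (h₂ : DifferentiableAt ℂ f₂ (conj (z * exp (β * I)))) :
    gradNorm (foldedWave β f₁ f₂) z ≤
      2 * (‖deriv f₁ (z * exp (β * I))‖ + ‖deriv f₂ (conj (z * exp (β * I)))‖) := by
  obtain ⟨L, hL, hLv⟩ := exists_hasFDerivAt_foldedWave h₁ h₂
  have hdir {v : ℂ} (hv : ‖v‖ = 1) :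
      ‖L v‖ ≤ ‖deriv f₁ (z * exp (β * I))‖ + ‖deriv f₂ (conj (z * exp (β * I)))‖ := by
    rw [hLv]
    refine (norm_add_le _ _).trans_eq ?_
    simp [hv, norm_exp_ofReal_mul_I]
  rw [gradNorm, hL.fderiv]
  refine Real.sqrt_le_iff.2 ⟨by positivity, ?_⟩
  have hone := pow_le_pow_left₀ (norm_nonneg _) (hdir norm_one) 2
  have hI := pow_le_pow_left₀ (norm_nonneg _) (hdir norm_I) 2
  rw [mul_pow]
  linarith [sq_nonneg (‖deriv f₁ (z * exp (β * I))‖ + ‖deriv f₂ (conj (z * exp (β * I)))‖)]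

theorem remainderBound_foldedWave (hβ : β < π / 2)
    (hd₁ : ∀ w : ℂ, 0 < w.re → DifferentiableAt ℂ f₁ w)
    (hd₂ : ∀ w : ℂ, 0 < w.re → DifferentiableAt ℂ f₂ w)
    (h₁ : ∀ ρ θ : ℝ, 1 ≤ ρ → |θ| ≤ β →
      ‖f₁ (ρ * exp (θ * I))‖ + ρ * ‖deriv f₁ (ρ * exp (θ * I))‖ ≤ K * ρ ^ (-μ))
    (h₂ : ∀ ρ θ : ℝ, 1 ≤ ρ → |θ| ≤ β →
      ‖f₂ (ρ * exp (θ * I))‖ + ρ * ‖deriv f₂ (ρ * exp (θ * I))‖ ≤ K * ρ ^ (-μ)) :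
    RemainderBound (2 * β) (foldedWave β f₁ f₂) μ (4 * K) 1 := by
  intro z hz hz1
  obtain ⟨θ, hθ, hpolar, hpolar_conj⟩ := exists_polar_of_mem_sector hz
  have hρ : 0 < ‖z‖ := by linarith
  have hneg : |-θ| ≤ β := by rwa [abs_neg]
  have hb₁ := h₁ ‖z‖ θ hz1 hθ
  have hb₂ := h₂ ‖z‖ (-θ) hz1 hneg
  rw [← hpolar] at hb₁
  rw [← hpolar_conj] at hb₂
  have hgrad : gradNorm (foldedWave β f₁ f₂) z ≤
      2 * (‖deriv f₁ (z * exp (β * I))‖ + ‖deriv f₂ (conj (z * exp (β * I)))‖) :=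
    gradNorm_foldedWave_le
      (hd₁ _ (by rw [hpolar]; exact re_polar_pos hρ (hθ.trans_lt hβ)))
      (hd₂ _ (by rw [hpolar_conj]; exact re_polar_pos hρ (hneg.trans_lt hβ)))
  have hnorm : ‖foldedWave β f₁ f₂ z‖ ≤
      ‖f₁ (z * exp (β * I))‖ + ‖f₂ (conj (z * exp (β * I)))‖ := norm_add_le _ _
  linarith [mul_le_mul_of_nonneg_left hgrad hρ.le, norm_nonneg (f₁ (z * exp (β * I))),
    norm_nonneg (f₂ (conj (z * exp (β * I))))]

theorem waveOut_eq (h : EuclideanSpace ℂ (Fin 2)) (z : ℂ) :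
    waveOut h z = h 0 * exp (I * conj z) + h 1 * exp (-(I * z)) := by
  have hconj : exp (I * conj z) = Real.exp z.im * exp (z.re * I) := by
    rw [ofReal_exp, ← exp_add]
    congr 1
    apply Complex.ext <;> simp
  have hneg : exp (-(I * z)) = Real.exp z.im * exp (-(z.re * I)) := by
    rw [ofReal_exp, ← exp_add]
    congr 1
    apply Complex.ext <;> simp
  simp only [waveOut, cdot, expVec, Matrix.cons_val_zero, Matrix.cons_val_one,
    mul_comm I (z.re : ℂ), ← conj_exp_ofReal_mul_I, conj_conj, hconj, hneg]
  ring

theorem expAtom_edgeAngle (β : ℝ) (w : ℂ) :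
    expAtom (edgeAngle β * I) w = exp (-(I * (w * exp (-(β * I))))) := by
  have hexp : exp (edgeAngle β * I) = I * exp (-(β * I)) := by
    rw [edgeAngle, ofReal_sub, ofReal_div, ofReal_ofNat, sub_mul, sub_eq_add_neg, exp_add,
      exp_pi_div_two_mul_I]
  rw [expAtom, hexp, mul_left_comm]

theorem expAtom_neg_edgeAngle (β : ℝ) (w : ℂ) :
    expAtom ((-edgeAngle β : ℝ) * I) w = exp (I * (w * exp (β * I))) := by
  have hexp : exp ((-edgeAngle β : ℝ) * I) = -(I * exp (β * I)) := by
    rw [edgeAngle, neg_sub, ofReal_sub, ofReal_div, ofReal_ofNat, sub_mul, exp_sub,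
      exp_pi_div_two_mul_I, div_I, mul_comm]
  rw [expAtom, hexp, mul_neg, neg_neg, mul_left_comm]

theorem waveOut_add_waveIn_eq_foldedWave (β : ℝ) (a₁ a₂ b₁ b₂ z : ℂ) :
    waveOut !₂[b₂, a₁] z + waveIn (2 * β) !₂[b₁, a₂] z =
      foldedWave β
        (fun w => a₁ * expAtom (edgeAngle β * I) w + a₂ * expAtom ((-edgeAngle β : ℝ) * I) w)
        (fun w => b₁ * expAtom (edgeAngle β * I) w + b₂ * expAtom ((-edgeAngle β : ℝ) * I) w)
        z := by
  have hcancel : exp (-(β * I)) * exp (β * I) = 1 := by rw [← exp_add, neg_add_cancel, exp_zero]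
  have hsq : exp (-((2 * β : ℝ) * I)) = exp (-(β * I)) * exp (-(β * I)) := by
    rw [← exp_add]
    push_cast
    ring_nf
  have hconj : conj (exp (-(β * I))) = exp (β * I) := by
    rw [← conj_exp_ofReal_mul_I, conj_conj]
  have hrot (c : ℂ) : c * exp (β * I) * exp (-(β * I)) = c := by
    rw [mul_assoc, mul_comm (exp _), hcancel, mul_one]
  have hrot' (c : ℂ) : c * exp (-(β * I)) * exp (β * I) = c := by
    rw [mul_assoc, hcancel, mul_one]
  simp only [waveIn, waveOut_eq, reflect, foldedWave, hsq, expAtom_edgeAngle,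
    expAtom_neg_edgeAngle, Matrix.cons_val_zero, Matrix.cons_val_one, map_mul,
    conj_exp_ofReal_mul_I, hconj, conj_conj, hrot, hrot']
  rw [mul_rotate, mul_rotate (exp (β * I))]
  ring_nf

end FoldedWave

section Modes

open Complex
open scoped Real

/-- The incoming amplitudes of `a` times the wave that is even and `b` times the wave that is odd
with respect to the bisector, when the phase shift of the edge is `σ`. Their outgoing amplitudes
are those for the phase shift `-σ`. -/
noncomputable def modeAmplitudes (σ : ℝ) (a b : ℂ) : EuclideanSpace ℂ (Fin 2) :=
  !₂[a * exp (-(I * σ)) - b * exp (I * σ), a * exp (I * σ) + b * exp (-(I * σ))]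

theorem modeAmplitudes_neg (σ : ℝ) (a b : ℂ) :
    modeAmplitudes (-σ) a b =
      !₂[a * exp (I * σ) - b * exp (-(I * σ)), a * exp (-(I * σ)) + b * exp (I * σ)] := by
  rw [modeAmplitudes, ofReal_neg, mul_neg, neg_neg]

theorem IsDecayingProfile.exists_bound_const_mul_add_const_mul {β μ : ℝ} {g g' : ℂ → ℂ}
    (hβ : β < π / 2) (hg : IsDecayingProfile β μ g) (hg' : IsDecayingProfile β μ g') :
    ∃ K, 0 < K ∧ ∀ (a b : ℂ) (ρ θ : ℝ), 1 ≤ ρ → |θ| ≤ β →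
      ‖a * g (ρ * exp (θ * I)) + b * g' (ρ * exp (θ * I))‖ +
        ρ * ‖deriv (fun w => a * g w + b * g' w) (ρ * exp (θ * I))‖ ≤
      K * (‖a‖ + ‖b‖) * ρ ^ (-μ) := by
  obtain ⟨C, hC, hbound⟩ := hg.decay
  obtain ⟨C', hC', hbound'⟩ := hg'.decay
  refine ⟨C + C' + 1, by positivity, fun a b ρ θ hρ hθ => ?_⟩
  have hre : 0 < (ρ * exp (θ * I)).re := re_polar_pos (by linarith) (hθ.trans_lt hβ)
  have hsum := norm_add_le (a * g (ρ * exp (θ * I))) (b * g' (ρ * exp (θ * I)))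
  have hsum_deriv := norm_add_le (a * deriv g (ρ * exp (θ * I))) (b * deriv g' (ρ * exp (θ * I)))
  rw [norm_mul, norm_mul] at hsum hsum_deriv
  rw [(((hg.differentiableAt _ hre).hasDerivAt.const_mul a).fun_add
    ((hg'.differentiableAt _ hre).hasDerivAt.const_mul b)).deriv]
  calc
    _ ≤ ‖a‖ * (‖g (ρ * exp (θ * I))‖ + ρ * ‖deriv g (ρ * exp (θ * I))‖) +
          ‖b‖ * (‖g' (ρ * exp (θ * I))‖ + ρ * ‖deriv g' (ρ * exp (θ * I))‖) := by
      linarith [mul_le_mul_of_nonneg_left hsum_deriv (by linarith : 0 ≤ ρ)]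
    _ ≤ ‖a‖ * ((C + C' + 1) * ρ ^ (-μ)) + ‖b‖ * ((C + C' + 1) * ρ ^ (-μ)) := by
      gcongr
      · exact (hbound ρ θ hρ hθ).trans (by gcongr; linarith)
      · exact (hbound' ρ θ hρ hθ).trans (by gcongr; linarith)
    _ = _ := by ring

theorem remainder_foldedWave (β : ℝ) (a b : ℂ) (g g' : ℂ → ℂ) :
    remainder (2 * β) (modeAmplitudes (edgePhase β) a b) (modeAmplitudes (-edgePhase β) a b)
        (foldedWave β
          (fun w => a * (edgeWaves β 1 w + g w) + b * (edgeWaves β (-1) w + g' w))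
          (fun w => a * (edgeWaves β 1 w + g w) - b * (edgeWaves β (-1) w + g' w))) =
      foldedWave β (fun w => a * g w + b * g' w) (fun w => a * g w + -b * g' w) := by
  funext z
  rw [remainder, sub_sub, modeAmplitudes_neg, modeAmplitudes, waveOut_add_waveIn_eq_foldedWave]
  simp only [foldedWave, edgeWaves, ofReal_one, ofReal_neg, mul_one, mul_neg, neg_mul, neg_neg]
  ring

theorem exists_isRobinSolution_modeAmplitudes {β : ℝ} (hβ : 0 < β) (hβ' : β < π / 2) :
    ∃ K, 0 < K ∧ ∀ a b : ℂ, ∃ Φ, IsRobinSolution (2 * β) Φ ∧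
      RemainderBound (2 * β) (remainder (2 * β) (modeAmplitudes (edgePhase β) a b)
        (modeAmplitudes (-edgePhase β) a b) Φ) (π / (2 * β)) (K * (‖a‖ + ‖b‖)) 1 := by
  have habs : |β| < π / 2 := by rwa [abs_of_pos hβ]
  obtain ⟨g, hg, hdefect⟩ := hasEdgeProfile hβ hβ' (Or.inl rfl)
  obtain ⟨g', hg', hdefect'⟩ := hasEdgeProfile hβ hβ' (Or.inr rfl)
  simp only [ofReal_one, ofReal_neg] at hdefect hdefect'
  obtain ⟨K, hK, hdecay⟩ := hg.exists_bound_const_mul_add_const_mul hβ' hg'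
  have hwaves (ε : ℝ) : Differentiable ℂ (edgeWaves β ε) := fun w =>
    ((hasDerivAt_expAtom _ w).differentiableAt.const_mul _).add
      ((hasDerivAt_expAtom _ w).differentiableAt.const_mul _)
  have hd (w : ℂ) (hw : 0 < w.re) := (hwaves 1 w).fun_add (hg.differentiableAt w hw)
  have hd' (w : ℂ) (hw : 0 < w.re) := (hwaves (-1) w).fun_add (hg'.differentiableAt w hw)
  have hcomb (a b w : ℂ) (hw : 0 < w.re) : DifferentiableAt ℂ (fun w => a * g w + b * g' w) w :=
    ((hg.differentiableAt w hw).const_mul a).add ((hg'.differentiableAt w hw).const_mul b)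
  refine ⟨4 * K, by positivity, fun a b => ⟨_, isRobinSolution_foldedWave hβ hβ'
    (f := fun w => a * (edgeWaves β 1 w + g w)) (f' := fun w => b * (edgeWaves β (-1) w + g' w))
    (fun w hw => (hd w hw).const_mul a) (fun w hw => (hd' w hw).const_mul b)
    (continuousOn_const.mul ((hwaves 1).continuous.continuousOn.add hg.continuousOn))
    (continuousOn_const.mul ((hwaves (-1)).continuous.continuousOn.add hg'.continuousOn))
    (fun t ht => ?_) fun t ht => ?_, ?_⟩⟩
  · rw [robinDefect_const_mul habs ht hd, hdefect t ht, mul_zero]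
  · rw [robinDefect_const_mul habs ht hd', hdefect' t ht, mul_zero]
  · rw [remainder_foldedWave, mul_assoc]
    refine remainderBound_foldedWave hβ' (hcomb a b) (hcomb a (-b)) (hdecay a b) ?_
    simpa only [norm_neg] using hdecay a (-b)

end Modes

section Amplitudes

open Complex
open scoped Real

variable {α β σ : ℝ}

theorem RemainderBound.mono {r C C' ρ₀ : ℝ} {R : ℂ → ℂ} (h : RemainderBound α R r C ρ₀)
    (hC : C ≤ C') : RemainderBound α R r C' ρ₀ := fun z hz hρ =>
  (h z hz hρ).trans (by gcongr)

theorem two_mul_edgePhase (hβ : β ≠ 0) : 2 * edgePhase β = π ^ 2 / (2 * (2 * β)) - π / 2 := by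
  rw [edgePhase]
  field_simp
  ring

theorem exp_I_mul_sq (σ : ℝ) :
    exp (I * σ) ^ 2 = Real.cos (2 * σ) + I * Real.sin (2 * σ) := by
  rw [← exp_nat_mul, ofReal_cos, ofReal_sin, mul_comm I (sin _), ← exp_mul_I]
  push_cast
  ring_nf

theorem exp_neg_I_mul_sq (σ : ℝ) :
    exp (-(I * σ)) ^ 2 = Real.cos (2 * σ) - I * Real.sin (2 * σ) := by
  simpa [sub_eq_add_neg] using exp_I_mul_sq (-σ)

theorem exp_I_mul_mul_exp_neg (σ : ℝ) : exp (I * σ) * exp (-(I * σ)) = 1 := by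
  rw [← exp_add, add_neg_cancel, exp_zero]

theorem norm_exp_neg_I_mul (σ : ℝ) : ‖exp (-(I * σ))‖ = 1 := by
  rw [exp_neg, norm_inv, norm_exp_I_mul_ofReal, inv_one]

theorem eq_vec_two_of_apply_eq {h : EuclideanSpace ℂ (Fin 2)} {x y : ℂ} (h0 : h 0 = x)
    (h1 : h 1 = y) : h = !₂[x, y] := by
  ext i
  fin_cases i
  · exact h0
  · exact h1

theorem exists_modeAmplitudes_eq (hσ : Real.cos (2 * σ) ≠ 0) (h : EuclideanSpace ℂ (Fin 2)) :
    ∃ a b, modeAmplitudes σ a b = h ∧ ‖a‖ + ‖b‖ ≤ 2 / |Real.cos (2 * σ)| * ‖h‖ := by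
  have hcos : (Real.cos (2 * σ) : ℂ) ≠ 0 := ofReal_ne_zero.2 hσ
  have hsq := exp_I_mul_sq σ
  have hsq_neg := exp_neg_I_mul_sq σ
  refine ⟨(h 0 * exp (-(I * σ)) + h 1 * exp (I * σ)) / (2 * Real.cos (2 * σ)),
    (h 1 * exp (-(I * σ)) - h 0 * exp (I * σ)) / (2 * Real.cos (2 * σ)), ?_, ?_⟩
  · refine (eq_vec_two_of_apply_eq ?_ ?_).symm
    · field_simp
      linear_combination -(h 0) * (hsq + hsq_neg)
    · field_simp
      linear_combination -(h 1) * (hsq + hsq_neg)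
  · have hnum : ‖h 0 * exp (-(I * σ)) + h 1 * exp (I * σ)‖ ≤ ‖h 0‖ + ‖h 1‖ := by
      simpa [norm_exp_neg_I_mul, norm_exp_I_mul_ofReal] using
        norm_add_le (h 0 * exp (-(I * σ))) (h 1 * exp (I * σ))
    have hnum' : ‖h 1 * exp (-(I * σ)) - h 0 * exp (I * σ)‖ ≤ ‖h 1‖ + ‖h 0‖ := by
      simpa [norm_exp_neg_I_mul, norm_exp_I_mul_ofReal] using
        norm_sub_le (h 1 * exp (-(I * σ))) (h 0 * exp (I * σ))
    have hpos : 0 < |Real.cos (2 * σ)| := abs_pos.2 hσ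
    rw [norm_div, norm_div, norm_mul, norm_ofNat, norm_real, Real.norm_eq_abs, ← add_div,
      div_mul_eq_mul_div, div_le_div_iff₀ (by positivity) hpos]
    have hle : ‖h 0‖ + ‖h 1‖ ≤ 2 * ‖h‖ := by
      linarith [PiLp.norm_apply_le h 0, PiLp.norm_apply_le h 1]
    nlinarith

theorem vertexTransfer_mulVec_modeAmplitudes (hβ : β ≠ 0)
    (hsin : Real.sin (π ^ 2 / (2 * (2 * β))) ≠ 0) (a b : ℂ) :
    WithLp.toLp 2 ((vertexTransfer (2 * β)).mulVec (modeAmplitudes (edgePhase β) a b).ofLp) =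
      modeAmplitudes (-edgePhase β) a b := by
  have hsq := exp_I_mul_sq (edgePhase β)
  have hsq_neg := exp_neg_I_mul_sq (edgePhase β)
  have hinv := exp_I_mul_mul_exp_neg (edgePhase β)
  rw [two_mul_edgePhase hβ, Real.cos_sub_pi_div_two, Real.sin_sub_pi_div_two] at hsq hsq_neg
  rw [ofReal_neg] at hsq hsq_neg
  rw [modeAmplitudes_neg, modeAmplitudes, vertexTransfer]
  generalize exp (I * edgePhase β) = E at *
  generalize exp (-(I * edgePhase β)) = F at *
  generalize π ^ 2 / (2 * (2 * β)) = κ at *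
  have hsin' : (Real.sin κ : ℂ) ≠ 0 := ofReal_ne_zero.2 hsin
  refine eq_vec_two_of_apply_eq ?_ ?_ <;>
    simp only [Matrix.mulVec, dotProduct, Fin.sum_univ_two, Matrix.of_apply, Matrix.cons_val',
      Matrix.cons_val_zero, Matrix.cons_val_one, Matrix.cons_val_fin_one, ofReal_div,
      ofReal_one] <;>
    field_simp
  · linear_combination a * (E * hsq_neg - F * hinv) - b * (F * hsq - E * hinv)
  · linear_combination a * (F * hsq - E * hinv) + b * (E * hsq_neg - F * hinv)

theorem sin_ne_zero_of_notMem_exceptionalAngles (hα : 0 < α) (h : α ∉ exceptionalAngles) :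
    Real.sin (π ^ 2 / (2 * α)) ≠ 0 := by
  intro hsin
  obtain ⟨n, hn⟩ := Real.sin_eq_zero_iff.1 hsin
  have hangle : (n : ℝ) * (2 * α) = π := by
    rw [eq_div_iff (by positivity)] at hn
    exact mul_left_cancel₀ Real.pi_ne_zero (by linarith)
  have hn0 : (0 : ℝ) < n := pos_of_mul_pos_left (hangle ▸ Real.pi_pos) (by positivity)
  lift n to ℕ using by exact_mod_cast hn0.le
  refine h ⟨n, by exact_mod_cast hn0, ?_⟩
  rw [eq_div_iff (by positivity)]
  push_cast at hangle
  linarith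

theorem angleParity_eq_one_or_neg_one {k : ℕ} (hk : 1 ≤ k) (hα : α = π / (2 * k)) :
    angleParity α = 1 ∨ angleParity α = -1 := by
  have : (0 : ℝ) < k := by exact_mod_cast hk
  have hangle : π ^ 2 / (2 * α) = k * π := by
    rw [hα]
    field_simp
  rw [angleParity, hangle, Real.cos_nat_mul_pi]
  exact neg_one_pow_eq_or ℝ k

theorem conj_exp_I_mul_pi_div_four : conj (exp (I * (π / 4))) = exp (-(I * (π / 4))) := by
  rw [← exp_conj, map_mul, conj_I, map_div₀, conj_ofReal, map_ofNat, neg_mul]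

theorem conj_exp_neg_I_mul_pi_div_four : conj (exp (-(I * (π / 4)))) = exp (I * (π / 4)) := by
  rw [← conj_exp_I_mul_pi_div_four, conj_conj]

theorem exp_neg_I_mul_pi_div_four : exp (-(I * (π / 4))) = -I * exp (I * (π / 4)) := by
  have hquarter : -(I * (π / 4)) = -(π / 2 * I) + I * (π / 4) := by ring
  rw [hquarter, exp_add, exp_neg, exp_pi_div_two_mul_I, inv_I]

theorem cdot_XEven (h : EuclideanSpace ℂ (Fin 2)) :
    cdot h XEven = 1 / (√2 : ℂ) * exp (I * (π / 4)) * (h 0 - I * h 1) := by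
  simp only [cdot, XEven, Matrix.cons_val_zero, Matrix.cons_val_one, map_mul, map_div₀, map_one,
    conj_ofReal, conj_exp_I_mul_pi_div_four, conj_exp_neg_I_mul_pi_div_four]
  rw [exp_neg_I_mul_pi_div_four]
  ring

theorem cdot_XOdd (h : EuclideanSpace ℂ (Fin 2)) :
    cdot h XOdd = 1 / (√2 : ℂ) * exp (I * (π / 4)) * (h 1 - I * h 0) := by
  simp only [cdot, XOdd, Matrix.cons_val_zero, Matrix.cons_val_one, map_mul, map_div₀, map_one,
    conj_ofReal, conj_exp_I_mul_pi_div_four, conj_exp_neg_I_mul_pi_div_four]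
  rw [exp_neg_I_mul_pi_div_four]
  ring

theorem apply_one_eq_of_cdot_XEven_eq_zero {h : EuclideanSpace ℂ (Fin 2)}
    (hX : cdot h XEven = 0) : h 1 = -I * h 0 := by
  have hrel : h 0 - I * h 1 = 0 := by simpa [cdot_XEven] using hX
  linear_combination I * hrel + h 1 * I_sq

theorem apply_one_eq_of_cdot_XOdd_eq_zero {h : EuclideanSpace ℂ (Fin 2)}
    (hX : cdot h XOdd = 0) : h 1 = I * h 0 := by
  have hrel : h 1 - I * h 0 = 0 := by simpa [cdot_XOdd] using hX
  linear_combination hrel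

theorem apply_one_eq_of_cdot_XVec_eq_zero (hα : angleParity α = 1 ∨ angleParity α = -1)
    {h : EuclideanSpace ℂ (Fin 2)} (hX : cdot h (XVec α) = 0) :
    h 1 = -(I * angleParity α) * h 0 := by
  rcases hα with hα | hα
  · rw [XVec, if_pos hα] at hX
    simp [hα, apply_one_eq_of_cdot_XEven_eq_zero hX]
  · rw [XVec, if_neg (by norm_num [hα])] at hX
    simp [hα, apply_one_eq_of_cdot_XOdd_eq_zero hX]

theorem apply_one_eq_of_cdot_XPerp_eq_zero (hα : angleParity α = 1 ∨ angleParity α = -1)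
    {h : EuclideanSpace ℂ (Fin 2)} (hX : cdot h (XPerp α) = 0) :
    h 1 = I * angleParity α * h 0 := by
  rcases hα with hα | hα
  · rw [XPerp, if_pos hα] at hX
    simp [hα, apply_one_eq_of_cdot_XOdd_eq_zero hX]
  · rw [XPerp, if_neg (by norm_num [hα])] at hX
    simp [hα, apply_one_eq_of_cdot_XEven_eq_zero hX]

theorem exp_I_mul_edgePhase_sq (hβ : β ≠ 0)
    (hα : angleParity (2 * β) = 1 ∨ angleParity (2 * β) = -1) :
    exp (I * edgePhase β) ^ 2 = -(I * angleParity (2 * β)) := by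
  have hsin : Real.sin (π ^ 2 / (2 * (2 * β))) = 0 := by
    rw [Real.sin_eq_zero_iff_cos_eq]
    exact hα
  rw [exp_I_mul_sq, two_mul_edgePhase hβ, Real.cos_sub_pi_div_two, Real.sin_sub_pi_div_two, hsin,
    angleParity]
  simp

theorem exists_modeAmplitudes_eq_and_eq {c : ℝ} (hc : c = 1 ∨ c = -1)
    (hσ : exp (I * σ) ^ 2 = -(I * c)) {hIn hOut : EuclideanSpace ℂ (Fin 2)}
    (hrel : hIn 1 = -(I * c) * hIn 0) (hrel' : hOut 1 = I * c * hOut 0) :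
    ∃ a b, modeAmplitudes σ a b = hIn ∧ modeAmplitudes (-σ) a b = hOut ∧
      ‖a‖ + ‖b‖ ≤ ‖hIn‖ + ‖hOut‖ := by
  have hinv := exp_I_mul_mul_exp_neg σ
  have hc_sq : (c : ℂ) ^ 2 = 1 := by rcases hc with rfl | rfl <;> simp
  have hc_norm : |c| = 1 := by rcases hc with rfl | rfl <;> simp
  refine ⟨(hIn 0 + I * c * hOut 0) / 2 * exp (I * σ),
    -(I * c * hIn 0 + hOut 0) / 2 * exp (I * σ), ?_, ?_, ?_⟩
  · refine (eq_vec_two_of_apply_eq ?_ ?_).symm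
    · linear_combination (-(hIn 0 + I * c * hOut 0) / 2) * hinv +
        (-(I * c * hIn 0 + hOut 0) / 2) * hσ + (hIn 0 / 2 * c ^ 2) * I_sq - hIn 0 / 2 * hc_sq
    · rw [hrel]
      linear_combination ((I * c * hIn 0 + hOut 0) / 2) * hinv -
        ((hIn 0 + I * c * hOut 0) / 2) * hσ + (hOut 0 / 2 * c ^ 2) * I_sq - hOut 0 / 2 * hc_sq
  · rw [modeAmplitudes_neg]
    refine (eq_vec_two_of_apply_eq ?_ ?_).symm
    · linear_combination (-(I * c * hIn 0 + hOut 0) / 2) * hinv -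
        ((hIn 0 + I * c * hOut 0) / 2) * hσ + (hOut 0 / 2 * c ^ 2) * I_sq - hOut 0 / 2 * hc_sq
    · rw [hrel']
      linear_combination (-(hIn 0 + I * c * hOut 0) / 2) * hinv +
        ((I * c * hIn 0 + hOut 0) / 2) * hσ - (hIn 0 / 2 * c ^ 2) * I_sq + hIn 0 / 2 * hc_sq
  · have ha : ‖hIn 0 + I * c * hOut 0‖ ≤ ‖hIn 0‖ + ‖hOut 0‖ := by
      simpa [hc_norm] using norm_add_le (hIn 0) (I * c * hOut 0)
    have hb : ‖I * c * hIn 0 + hOut 0‖ ≤ ‖hIn 0‖ + ‖hOut 0‖ := by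
      simpa [hc_norm] using norm_add_le (I * c * hIn 0) (hOut 0)
    rw [norm_mul, norm_mul, norm_div, norm_div, norm_neg, norm_exp_I_mul_ofReal, norm_ofNat]
    linarith [PiLp.norm_apply_le hIn 0, PiLp.norm_apply_le hOut 0]

end Amplitudes

theorem mainTheorem10 (α : ℝ) (hα_pos : 0 < α) (hα_lt : α < Real.pi) :
    (α ∉ exceptionalAngles →
      ∃ C : ℝ, 0 < C ∧ ∃ ρ₀ : ℝ, 0 < ρ₀ ∧
        ∀ hIn : EuclideanSpace ℂ (Fin 2), ∃ (hOut : EuclideanSpace ℂ (Fin 2)) (Φ : ℂ → ℂ),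
          IsRobinSolution α Φ ∧
          RemainderBound α (remainder α hIn hOut Φ) (Real.pi / α) (C * ‖hIn‖) ρ₀ ∧
          hOut = WithLp.toLp 2 ((vertexTransfer α).mulVec hIn.ofLp)) ∧
    (∀ k : ℕ, 1 ≤ k → α = Real.pi / (2 * k) →
      ∃ C : ℝ, 0 < C ∧ ∃ ρ₀ : ℝ, 0 < ρ₀ ∧
        ∀ hIn hOut : EuclideanSpace ℂ (Fin 2),
          cdot hIn (XVec α) = 0 → cdot hOut (XPerp α) = 0 →
          ∃ Φ : ℂ → ℂ,
            IsRobinSolution α Φ ∧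
            RemainderBound α (remainder α hIn hOut Φ) (Real.pi / α)
              (C * (‖hIn‖ + ‖hOut‖)) ρ₀) := by
  obtain ⟨β, rfl⟩ : ∃ β, α = 2 * β := ⟨α / 2, by ring⟩
  have hβ : 0 < β := by linarith
  obtain ⟨K, hK, hfamily⟩ := exists_isRobinSolution_modeAmplitudes hβ (by linarith)
  constructor
  · intro hα
    have hsin := sin_ne_zero_of_notMem_exceptionalAngles hα_pos hα
    have hcos : Real.cos (2 * edgePhase β) ≠ 0 := by
      rwa [two_mul_edgePhase hβ.ne', Real.cos_sub_pi_div_two]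
    refine ⟨K * (2 / |Real.cos (2 * edgePhase β)|), by positivity, 1, one_pos, fun hIn => ?_⟩
    obtain ⟨a, b, rfl, hnorm⟩ := exists_modeAmplitudes_eq hcos hIn
    obtain ⟨Φ, hΦ, hR⟩ := hfamily a b
    rw [vertexTransfer_mulVec_modeAmplitudes hβ.ne' hsin]
    exact ⟨_, Φ, hΦ, hR.mono (by rw [mul_assoc]; gcongr), rfl⟩
  · intro k hk hα
    have hparity := angleParity_eq_one_or_neg_one hk hα
    refine ⟨K, hK, 1, one_pos, fun hIn hOut hX hX' => ?_⟩
    obtain ⟨a, b, rfl, rfl, hnorm⟩ := exists_modeAmplitudes_eq_and_eq hparity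
      (exp_I_mul_edgePhase_sq hβ.ne' hparity) (apply_one_eq_of_cdot_XVec_eq_zero hparity hX)
      (apply_one_eq_of_cdot_XPerp_eq_zero hparity hX')
    obtain ⟨Φ, hΦ, hR⟩ := hfamily a b
    exact ⟨Φ, hΦ, hR.mono (by gcongr)⟩
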